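/- **Setting.** Let $d\ge 2$. For $N\ge1$ let $\mathbb T=(\mathbb Z/N\mathbb Z)^d$, let $E=\mathbb T\times\mathbb Z$, and let $\pi_E:\mathbb Z^{d+1}\to E$ be the canonical projection; $|\cdot|$ on $E$ denotes the distance induced by the Euclidean distance of $\mathbb Z^{d+1}$. $P_x$ is the law of simple random walk $X=(Y,Z)$ on $E$ (the projection of simple random walk on $\mathbb Z^{d+1}$) started at $x$, and $P_{\nu_z}=N^{-d}\sum_{y\in\mathbb T}P_{(y,z)}$. Write $H_U=\inf\{n\ge0: X_n\in U\}$, $\widetilde H_U=\inf\{n\ge1:X_n\in U\}$, $T_U=\inf\{n\ge0:X_n\notin U\}$. For finite $K\subseteq U\subsetneq E$ put $\mathrm{cap}_U(K)=\sum_{x\in K}P_x[\widetilde H_K>T_U]$, and for finite $K\subset\mathbb Z^{d+1}$ put $\mathrm{cap}(K)=\sum_{x\in K}P^{\mathbb Z^{d+1}}_x[\widetilde H_K=\infty]$. Let $M\ge1$, let $K_1,\dots,K_M\subset\mathbb Z^{d+1}$ be finite, and for each $N$ let $x_1,\dots,x_M\in E$, with $\mathbb Z$-components $z_1,\dots,z_M$,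 be such that $|x_i-x_j|\to\infty$ for $i\ne j$ and $z_i/N^d\to v_i\in\mathbb R$ as $N\to\infty$. Let $w_1<\dots<w_L$ be the distinct values of the $v_i$, and let $\mathcal I_\ell=\{i:v_i=w_\ell\}$. Let $h_N,d_N$ be sequences of non-negative integers tending to infinity such that $h_N=o(N^d)$, $h_N\ge N(\log N)^2$, $d_N=o(h_N)$ and $1+\max_\ell\max_{i,i'\in\mathcal I_\ell}|z_i-z_{i'}|=o(d_N)$. Put $z^*_\ell=\max\{z_i:i\in\mathcal I_\ell\}$, $I_\ell=z^*_\ell+[-d_N,d_N]$, $\widetilde I_\ell=z^*_\ell+(-h_N,h_N)$ (intervals in $\mathbb Z$), $\widetilde B_\ell=\mathbb T\times\widetilde I_\ell$ and $C_\ell=\bigcup_{i\in\mathcal I_\ell}(x_i+K_i)$, where $x_i+K_i$ means $x_i+\pi_E(K_i)\subset E$. Let $$\mathcal G=\{z^*_1,\dots,z^*_L\}\cup\{z\in2h_N\mathbb Z:\ |z-z^*_\ell|\ge2h_N\text{ for all }\ell\},$$ let $R_1$ be the entrance time of $X$ in $\mathbb T\times(\mathcal G+[-d_N,d_N])$, let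 $D_1\ge R_1$ be the first time after $R_1$ at which $X$ is outside $\mathbb T\times(\mathcal G+(-h_N,h_N))$, and set $P_{z,z'}=P_{\nu_z}[\,\cdot\mid Z_{D_1}=z']$. (For large $N$ and $z\in I_\ell$, $D_1$ is $P_{\nu_z}$-almost surely the exit time of $\widetilde B_\ell$, so that $P_{z,z'}$ is the law of the walk started uniformly on the level $\mathbb T\times\{z\}$ and conditioned to exit $\widetilde B_\ell$ at level $z'$.) For $A\subset\mathbb Z$ let $\partial A=\{z\notin A:\exists z'\in A,\ |z-z'|=1\}$ and $\partial_{\rm int}A=\{z\in A:\exists z'\notin A,\ |z-z'|=1\}$. **Lemma 4.2.** There is a constant $c>0$ depending only on $d$ such that in the above setting, for all large $N$, all $1\le\ell\le L$, all $z_1\in\partial_{\rm int}I_\ell$ and all $z_2\in\partial\widetilde I_\ell$, $$P_{z_1,z_2}\big[H_{C_\ell}<T_{\widetilde B_\ell}\big]=(d+1)\,\frac{h_N}{N^d}\,\mathrm{cap}_{\widetilde B_\ell}(C_\ell)\,\big(1+\Psi_\ell(z_1,z_2)\big),\qquad|\Psi_\ell(z_1,z_2)|\le c\,\frac{d_N}{h_N}.$$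 Moreover, for each $1\le\ell\le L$, $$\lim_{N\to\infty}\mathrm{cap}_{\widetilde B_\ell}(C_\ell)=\sum_{i\in\mathcal I_\ell}\mathrm{cap}(K_i).$$ -/

import Mathlib

open MeasureTheory ProbabilityTheory Filter Topology Asymptotics
open scoped ENNReal

namespace CylinderWalk

noncomputable section

/-- The lattice `ℤ^(d+1)`. -/
abbrev ZLat (d : ℕ) : Type := Fin (d + 1) → ℤ

/-- The torus `𝕋 = (ℤ / Nℤ)^d`. -/
abbrev Torus (d N : ℕ) : Type := Fin d → ZMod N

/-- The discrete cylinder `E = 𝕋 × ℤ`. -/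
abbrev Cyl (d N : ℕ) : Type := Torus d N × ℤ

/-- The canonical projection `π_E : ℤ^(d+1) → E`; the last coordinate is the vertical one. -/
def proj (d N : ℕ) (u : ZLat d) : Cyl d N :=
  (fun j => ((u j.castSucc : ℤ) : ZMod N), u (Fin.last d))

/-- The distance on `E` induced by the Euclidean distance on `ℤ^(d+1)`: the least Euclidean length
of a lattice vector that projects onto the difference. -/
def cylDist {d N : ℕ} (x y : Cyl d N) : ℝ :=
  sInf {r : ℝ | ∃ u : ZLat d, proj d N u = x - y ∧ r = √(∑ j, (u j : ℝ) ^ 2)}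

/-! ### Simple random walk -/

/-- The `2 (d + 1)` unit steps `± e_j` of the lattice. -/
def unitStep (d : ℕ) (p : Fin (d + 1) × Bool) : ZLat d :=
  Pi.single p.1 (if p.2 then 1 else -1)

/-- The law, on the space of trajectories `ℕ → G`, of the walk `n ↦ x + s (ω 0) + ⋯ + s (ω (n-1))`,
where the `ω k` are independent and uniformly distributed on the `2 (d + 1)` directions. -/
def walkLaw {d : ℕ} {G : Type*} [AddCommGroup G] [MeasurableSpace G]
    (s : Fin (d + 1) × Bool → G) (x : G) : Measure (ℕ → G) :=
  (Measure.infinitePi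
      (fun _ : ℕ => (PMF.uniformOfFintype (Fin (d + 1) × Bool)).toMeasure)).map
    (fun ω n => x + ∑ k ∈ Finset.range n, s (ω k))

/-- `P_x^{ℤ^(d+1)}`: the law of simple random walk on `ℤ^(d+1)` started at `x`. -/
def latticeLaw (d : ℕ) (x : ZLat d) : Measure (ℕ → ZLat d) :=
  walkLaw (unitStep d) x

/-- `P_x`: the law of simple random walk on the cylinder started at `x`. -/
def cylLaw (d N : ℕ) (x : Cyl d N) : Measure (ℕ → Cyl d N) :=
  walkLaw (fun p => proj d N (unitStep d p)) x

/-- `P_{ν_z}`: the law of simple random walk on the cylinder started with the uniform distribution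
`ν_z` on the level `𝕋 × {z}`, that is `N^{-d} ∑_{y ∈ 𝕋} P_{(y,z)}`. -/
def levelLaw (d N : ℕ) (z : ℤ) : Measure (ℕ → Cyl d N) :=
  ((N : ℝ≥0∞) ^ d)⁻¹ • Measure.sum (fun y : Torus d N => cylLaw d N (y, z))

/-! ### Entrance, hitting and exit times, with values in `ℕ ∪ {∞}` -/

/-- The entrance time `H_U = inf {n ≥ 0 : X_n ∈ U}`. -/
def entranceTime {S : Type*} (U : Set S) (w : ℕ → S) : WithTop ℕ :=
  hittingAfter (fun n (w : ℕ → S) => w n) U 0 w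

/-- The hitting time `inf {n ≥ 1 : X_n ∈ U}`. -/
def hitTime {S : Type*} (U : Set S) (w : ℕ → S) : WithTop ℕ :=
  hittingAfter (fun n (w : ℕ → S) => w n) U 1 w

/-- The exit time `T_U = inf {n ≥ 0 : X_n ∉ U}`. -/
def exitTime {S : Type*} (U : Set S) (w : ℕ → S) : WithTop ℕ :=
  entranceTime Uᶜ w

/-! ### Capacities -/

/-- `cap_U(K)` on the cylinder: the sum over `x ∈ K` of the probability, starting from `x`, that the
walk leaves `U` before it returns to `K`. -/
def cylCap {d N : ℕ} (U : Set (Cyl d N)) (K : Finset (Cyl d N)) : ℝ :=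
  ∑ x ∈ K, (cylLaw d N x).real {w | exitTime U w < hitTime (K : Set (Cyl d N)) w}

/-- `cap(K)` on `ℤ^(d+1)`: the sum over `x ∈ K` of the probability, starting from `x`, that the walk
never returns to `K`. -/
def latticeCap {d : ℕ} (K : Finset (ZLat d)) : ℝ :=
  ∑ x ∈ K, (latticeLaw d x).real {w | hitTime (K : Set (ZLat d)) w = ⊤}

/-! ### Intervals, boundaries, blocks -/

/-- The outer boundary of a set of integers. -/
def bdry (U : Set ℤ) : Set ℤ := {z | z ∉ U ∧ ∃ z' ∈ U, |z - z'| = 1}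

/-- The inner boundary of a set of integers. -/
def innerBdry (U : Set ℤ) : Set ℤ := {z | z ∈ U ∧ ∃ z', z' ∉ U ∧ |z - z'| = 1}

/-- `ζ + [-δ, δ]`. -/
def smallInterval (δ : ℕ) (ζ : ℤ) : Set ℤ := Set.Icc (ζ - δ) (ζ + δ)

/-- `ζ + (-η, η)`. -/
def bigInterval (η : ℕ) (ζ : ℤ) : Set ℤ := Set.Ioo (ζ - η) (ζ + η)

/-- The part `𝕋 × I` of the cylinder. -/
def block (d N : ℕ) (I : Set ℤ) : Set (Cyl d N) := {p | p.2 ∈ I}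

/-! ### The grid and the excursions -/

/-- The grid with special points `ζ_1, …, ζ_L`: these points together with the points of `2ηℤ` at
distance at least `2η` from all of them. -/
def grid {L : ℕ} (η : ℕ) (ζ : Fin L → ℤ) : Set ℤ :=
  Set.range ζ ∪ {z | (∃ k : ℤ, z = 2 * η * k) ∧ ∀ l, 2 * (η : ℤ) ≤ |z - ζ l|}

/-- The set `𝕋 × (grid + [-δ, δ])`. -/
def returnRegion (d N : ℕ) {L : ℕ} (δ η : ℕ) (ζ : Fin L → ℤ) : Set (Cyl d N) :=
  block d N (⋃ g ∈ grid η ζ, smallInterval δ g)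

/-- The set `𝕋 × (grid + (-η, η))`. -/
def departureRegion (d N : ℕ) {L : ℕ} (η : ℕ) (ζ : Fin L → ℤ) : Set (Cyl d N) :=
  block d N (⋃ g ∈ grid η ζ, bigInterval η g)

/-- The first return time `R_1`, the entrance time of `𝕋 × (grid + [-δ, δ])`. -/
def firstReturn (d N : ℕ) {L : ℕ} (δ η : ℕ) (ζ : Fin L → ℤ) (w : ℕ → Cyl d N) : WithTop ℕ :=
  entranceTime (returnRegion d N δ η ζ) w

/-- The first departure time `D_1`: the first exit after `R_1` from `𝕋 × (grid + (-η, η))`, that is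
`R_1 + T ∘ θ_{R_1}` with `T` the exit time (and `∞` when `R_1 = ∞`). -/
def firstDeparture (d N : ℕ) {L : ℕ} (δ η : ℕ) (ζ : Fin L → ℤ) (w : ℕ → Cyl d N) : WithTop ℕ :=
  firstReturn d N δ η ζ w +
    exitTime (departureRegion d N η ζ) (fun k => w ((firstReturn d N δ η ζ w).untopD 0 + k))

/-- `P_{z,z'} = P_{ν_z}[ · | Z_{D_1} = z']`, where `Z` is the vertical component of the walk. -/
def excursionLaw (d N : ℕ) {L : ℕ} (δ η : ℕ) (ζ : Fin L → ℤ) (z z' : ℤ) :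
    Measure (ℕ → Cyl d N) :=
  cond (levelLaw d N z)
    {w | ∃ n : ℕ, firstDeparture d N δ η ζ w = (n : WithTop ℕ) ∧ (w n).2 = z'}

/-! ### The clusters of points -/

open Classical in
/-- The set of indices `i` with `v_i = a`. -/
def cluster {M : ℕ} (v : Fin M → ℝ) (a : ℝ) : Finset (Fin M) :=
  Finset.univ.filter (fun i => v i = a)

/-- The largest vertical component of the points `x_i` with `v_i = a` (a maximum when `a` is
one of the values of `v`). -/
def topHeight {d N M : ℕ} (x : Fin M → Cyl d N) (v : Fin M → ℝ) (a : ℝ) : ℤ :=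
  sSup ((fun i => (x i).2) '' (cluster v a : Set (Fin M)))

/-- The union of the sets `x_i + K_i` (that is, `x_i + π_E(K_i)`) over the `i` with `v_i = a`. -/
def clusterSet {d N M : ℕ} (x : Fin M → Cyl d N) (K : Fin M → Finset (ZLat d))
    (v : Fin M → ℝ) (a : ℝ) : Finset (Cyl d N) :=
  (cluster v a).biUnion (fun i => (K i).image (fun u => x i + proj d N u))

end

end CylinderWalk

open CylinderWalk

namespace CylinderWalk

section

/-! ### The Markov property at time one -/

/-- The sequence with first term `p` and remaining terms `ω`. -/
def seqCons {T : Type*} (q : T × (ℕ → T)) : ℕ → T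
  | 0 => q.1
  | n + 1 => q.2 n

theorem measurable_seqCons {T : Type*} [MeasurableSpace T] :
    Measurable (seqCons : T × (ℕ → T) → ℕ → T) := by
  refine measurable_pi_lambda _ fun n => ?_
  cases n with
  | zero => exact measurable_fst
  | succ n => exact (measurable_pi_apply n).comp measurable_snd

theorem map_seqCons_infinitePi {T : Type*} [MeasurableSpace T] (μ : Measure T)
    [IsProbabilityMeasure μ] :
    (μ.prod (Measure.infinitePi fun _ : ℕ => μ)).map seqCons =
      Measure.infinitePi fun _ : ℕ => μ := by
  refine Measure.eq_infinitePi _ fun S t ht => ?_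
  have hT : ∀ n, MeasurableSet (if n ∈ S then t n else Set.univ) := by
    intro n; split_ifs
    · exact ht n
    · exact MeasurableSet.univ
  have hpre : seqCons ⁻¹' (Set.pi S t) =
      (if 0 ∈ S then t 0 else Set.univ) ×ˢ
        Set.pi ((Finset.range (S.sup id)) : Set ℕ)
          (fun n => if n + 1 ∈ S then t (n + 1) else Set.univ) := by
    ext q
    simp only [Set.mem_preimage, Set.mem_pi, Set.mem_prod, Finset.mem_coe, Finset.mem_range]
    constructor
    · intro h
      refine ⟨?_, fun n _ => ?_⟩
      · split_ifs with h0
        · exact h 0 h0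
        · trivial
      · split_ifs with h0
        · exact h (n + 1) h0
        · trivial
    · rintro ⟨h0, h1⟩ n hn
      cases n with
      | zero =>
        rw [if_pos hn] at h0
        exact h0
      | succ n =>
        have hlt : n < S.sup id := Nat.lt_of_succ_le (Finset.le_sup (f := id) hn)
        have h2 := h1 n hlt
        rw [if_pos hn] at h2
        exact h2
  rw [Measure.map_apply measurable_seqCons
    (MeasurableSet.pi S.countable_toSet fun i _ => ht i), hpre, Measure.prod_prod,
    Measure.infinitePi_pi _ (fun n _ => hT (n + 1))]
  have hsub : S ⊆ Finset.range (S.sup id + 1) := by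
    intro n hn
    exact Finset.mem_range.2 (Nat.lt_succ_of_le (Finset.le_sup (f := id) hn))
  have : ∏ i ∈ S, μ (t i) =
      ∏ i ∈ Finset.range (S.sup id + 1), μ (if i ∈ S then t i else Set.univ) := by
    rw [← Finset.prod_subset hsub]
    · exact Finset.prod_congr rfl fun i hi => by rw [if_pos hi]
    · intro i _ hi
      rw [if_neg hi, measure_univ]
  rw [this, Finset.prod_range_succ', mul_comm]

variable {d : ℕ} {G : Type*} [AddCommGroup G]

/-- The average of `f` over the `2 (d + 1)` points that the walk with steps `s` can reach from `x`
in one step. -/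
noncomputable def stepAvg (s : Fin (d + 1) × Bool → G) (f : G → ℝ) (x : G) : ℝ :=
  (∑ p, f (x + s p)) / (2 * ((d : ℝ) + 1))

/-- The trajectory with starting point `x` and increments `s (ω n)`. -/
def walkPath (s : Fin (d + 1) × Bool → G) (x : G) (ω : ℕ → Fin (d + 1) × Bool) (n : ℕ) : G :=
  x + ∑ k ∈ Finset.range n, s (ω k)

theorem walkPath_seqCons_succ (s : Fin (d + 1) × Bool → G) (x : G)
    (q : (Fin (d + 1) × Bool) × (ℕ → Fin (d + 1) × Bool)) (n : ℕ) :
    walkPath s x (seqCons q) (n + 1) = walkPath s (x + s q.1) q.2 n := by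
  simp only [walkPath, Finset.sum_range_succ', seqCons]
  abel

variable [MeasurableSpace G] [Countable G] [MeasurableSingletonClass G]

theorem measurable_walkPath (s : Fin (d + 1) × Bool → G) (x : G) :
    Measurable (walkPath s x) := by
  have : MeasurableAdd₂ G := ⟨Measurable.of_discrete⟩
  refine measurable_pi_lambda _ fun n => ?_
  refine measurable_const.add (Finset.measurable_sum _ fun k _ => ?_)
  exact (Measurable.of_discrete (f := s)).comp (measurable_pi_apply k)

theorem walkLaw_apply (s : Fin (d + 1) × Bool → G) (x : G) {A : Set (ℕ → G)}
    (hA : MeasurableSet A) :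
    walkLaw s x A = Measure.infinitePi
      (fun _ : ℕ => (PMF.uniformOfFintype (Fin (d + 1) × Bool)).toMeasure)
        (walkPath s x ⁻¹' A) :=
  Measure.map_apply (measurable_walkPath s x) hA

instance (s : Fin (d + 1) × Bool → G) (x : G) : IsProbabilityMeasure (walkLaw s x) :=
  Measure.isProbabilityMeasure_map (measurable_walkPath s x).aemeasurable

theorem walkLaw_real_congr (s : Fin (d + 1) × Bool → G) (x : G) {A B : Set (ℕ → G)}
    (hA : MeasurableSet A) (hB : MeasurableSet B)
    (h : ∀ w : ℕ → G, w 0 = x → (w ∈ A ↔ w ∈ B)) :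
    (walkLaw s x).real A = (walkLaw s x).real B := by
  rw [measureReal_def, measureReal_def, walkLaw_apply s x hA, walkLaw_apply s x hB]
  congr 2
  ext ω
  exact h _ (by simp [walkPath])

theorem walkLaw_real_eq_one (s : Fin (d + 1) × Bool → G) (x : G) {A : Set (ℕ → G)}
    (hA : MeasurableSet A) (h : ∀ w : ℕ → G, w 0 = x → w ∈ A) : (walkLaw s x).real A = 1 := by
  rw [walkLaw_real_congr s x hA MeasurableSet.univ (by simpa using h), probReal_univ]

theorem walkLaw_real_eq_zero (s : Fin (d + 1) × Bool → G) (x : G) {A : Set (ℕ → G)}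
    (hA : MeasurableSet A) (h : ∀ w : ℕ → G, w 0 = x → w ∉ A) : (walkLaw s x).real A = 0 := by
  rw [walkLaw_real_congr s x hA MeasurableSet.empty (by simpa using h), measureReal_empty]

/-- The Markov property at time one. -/
theorem walkLaw_real_eq_stepAvg (s : Fin (d + 1) × Bool → G) (x : G) {A B : Set (ℕ → G)}
    (hA : MeasurableSet A) (hB : MeasurableSet B)
    (h : ∀ w : ℕ → G, w 0 = x → (w ∈ A ↔ (fun n => w (n + 1)) ∈ B)) :
    (walkLaw s x).real A = stepAvg s (fun y => (walkLaw s y).real B) x := by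
  set μ := (PMF.uniformOfFintype (Fin (d + 1) × Bool)).toMeasure with hμ
  have hμ1 : IsProbabilityMeasure μ := by rw [hμ]; infer_instance
  have hm : MeasurableSet (walkPath s x ⁻¹' A) := measurable_walkPath s x hA
  have key : walkLaw s x A = ∑ p, ((2 * (d + 1) : ℕ) : ℝ≥0∞)⁻¹ * walkLaw s (x + s p) B := by
    rw [walkLaw_apply s x hA, ← hμ, ← map_seqCons_infinitePi μ,
      Measure.map_apply measurable_seqCons hm, Measure.prod_apply (measurable_seqCons hm),
      lintegral_fintype]
    refine Finset.sum_congr rfl fun p _ => ?_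
    rw [mul_comm]
    congr 1
    · rw [hμ, PMF.toMeasure_apply_singleton _ _ (measurableSet_singleton p),
        PMF.uniformOfFintype_apply]
      simp [mul_comm]
    · rw [walkLaw_apply _ _ hB]
      congr 1
      ext ω
      simp only [Set.mem_preimage]
      rw [h _ (by simp [walkPath])]
      have : (fun n => walkPath s x (seqCons (p, ω)) (n + 1)) = walkPath s (x + s p) ω := by
        funext n
        exact walkPath_seqCons_succ s x (p, ω) n
      rw [this]
  rw [measureReal_def, key, ENNReal.toReal_sum]
  · simp only [ENNReal.toReal_mul, ← Finset.mul_sum, stepAvg, measureReal_def]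
    rw [div_eq_inv_mul]
    congr 1
    rw [ENNReal.toReal_inv, ENNReal.toReal_natCast]
    push_cast
    rfl
  · intro p _
    exact ENNReal.mul_ne_top (by simp) (measure_ne_top _ _)

end

/-! ### The maximum principle -/

theorem nonpos_of_subharmonic {ι G : Type*} [Fintype ι] [AddCommGroup G] (s : ι → G) (p₀ : ι)
    (hinj : Function.Injective fun n : ℕ => n • s p₀) (f : G → ℝ)
    (hfin : ∀ ε > 0, {x | ε ≤ f x}.Finite)
    (hsub : ∀ x, 0 < f x → Fintype.card ι * f x ≤ ∑ p, f (x + s p)) (x : G) : f x ≤ 0 := by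
  by_contra! hx
  obtain ⟨a, ha, hmax⟩ := Set.exists_max_image {y | f x ≤ f y} f (hfin _ hx) ⟨x, le_refl (f x)⟩
  have hmax' : ∀ y, f y ≤ f a := by
    intro y
    rcases le_total (f x) (f y) with h | h
    · exact hmax y h
    · exact h.trans ha
  have hpos : 0 < f a := lt_of_lt_of_le hx ha
  have hstep : ∀ y, f y = f a → ∀ p, f (y + s p) = f a := by
    intro y hy p
    have h1 := hsub y (hy ▸ hpos)
    have h2 : ∑ p, (f a - f (y + s p)) ≤ 0 := by
      rw [Finset.sum_sub_distrib, Finset.sum_const, Finset.card_univ, nsmul_eq_mul, ← hy]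
      linarith
    have h3 := (Finset.sum_eq_zero_iff_of_nonneg
      (fun p _ => sub_nonneg.2 (hmax' (y + s p)))).1
      (le_antisymm h2 (Finset.sum_nonneg fun p _ => sub_nonneg.2 (hmax' (y + s p)))) p
      (Finset.mem_univ p)
    linarith
  have hline : ∀ n : ℕ, f (a + n • s p₀) = f a := by
    intro n
    induction n with
    | zero => simp
    | succ n ih => rw [succ_nsmul, ← add_assoc]; exact hstep _ ih p₀
  refine Set.infinite_range_of_injective (f := fun n : ℕ => a + n • s p₀) ?_
    ((hfin _ hpos).subset ?_)
  · intro m n h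
    exact hinj (add_left_cancel h)
  · rintro _ ⟨n, rfl⟩
    exact (hline n).ge

theorem stepAvg_subharmonic {d : ℕ} {G : Type*} [AddCommGroup G] (s : Fin (d + 1) × Bool → G)
    (f : G → ℝ) (x : G) (h : f x ≤ stepAvg s f x) :
    Fintype.card (Fin (d + 1) × Bool) * f x ≤ ∑ p, f (x + s p) := by
  rw [stepAvg, le_div_iff₀ (by positivity)] at h
  simp only [Fintype.card_prod, Fintype.card_fin, Fintype.card_bool]
  push_cast
  linarith

section stepAvg

variable {d : ℕ} {G : Type*} [AddCommGroup G] (s : Fin (d + 1) × Bool → G)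

theorem stepAvg_congr {f g : G → ℝ} {x : G} (h : ∀ p, f (x + s p) = g (x + s p)) :
    stepAvg s f x = stepAvg s g x := by
  simp only [stepAvg, h]

theorem stepAvg_mono {f g : G → ℝ} {x : G} (h : ∀ p, f (x + s p) ≤ g (x + s p)) :
    stepAvg s f x ≤ stepAvg s g x := by
  unfold stepAvg
  gcongr with p
  exact h p

theorem stepAvg_const (a : ℝ) (x : G) : stepAvg s (fun _ => a) x = a := by
  simp only [stepAvg, Finset.sum_const, Finset.card_univ, Fintype.card_prod, Fintype.card_fin,
    Fintype.card_bool, nsmul_eq_mul]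
  push_cast
  field_simp

theorem stepAvg_sub (f g : G → ℝ) (x : G) :
    stepAvg s (fun y => f y - g y) x = stepAvg s f x - stepAvg s g x := by
  simp only [stepAvg, Finset.sum_sub_distrib, sub_div]

theorem stepAvg_const_mul (a : ℝ) (f : G → ℝ) (x : G) :
    stepAvg s (fun y => a * f y) x = a * stepAvg s f x := by
  simp only [stepAvg, ← Finset.mul_sum, mul_div_assoc]

theorem stepAvg_sum {κ : Type*} (t : Finset κ) (f : κ → G → ℝ) (x : G) :
    stepAvg s (fun y => ∑ k ∈ t, f k y) x = ∑ k ∈ t, stepAvg s (f k) x := by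
  simp only [stepAvg]
  rw [Finset.sum_comm, Finset.sum_div]

end stepAvg

/-! ### Path events -/

theorem coe_lt_hittingAfter_iff {S : Type*} (U : Set S) (k n : ℕ) (w : ℕ → S) :
    (n : WithTop ℕ) < hittingAfter (fun n (w : ℕ → S) => w n) U k w ↔
      ∀ m, k ≤ m → m ≤ n → w m ∉ U := by
  constructor
  · intro h m hk hm
    exact notMem_of_lt_hittingAfter (lt_of_le_of_lt (WithTop.coe_le_coe.2 hm) h) hk
  · intro h
    unfold hittingAfter
    split_ifs with hex
    · have := Nat.sInf_mem (s := {i | k ≤ i ∧ w i ∈ U}) hex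
      by_contra hlt
      rw [not_lt] at hlt
      exact h _ this.1 (WithTop.coe_le_coe.1 hlt) this.2
    · exact WithTop.coe_lt_top n

theorem hittingAfter_eq_coe_iff {S : Type*} (U : Set S) (k n : ℕ) (w : ℕ → S) :
    hittingAfter (fun n (w : ℕ → S) => w n) U k w = (n : WithTop ℕ) ↔
      (k ≤ n ∧ w n ∈ U) ∧ ∀ m, k ≤ m → m < n → w m ∉ U := by
  constructor
  · intro h
    refine ⟨?_, fun m hk hm => notMem_of_lt_hittingAfter (lt_of_lt_of_eq (WithTop.coe_lt_coe.2 hm) h.symm) hk⟩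
    unfold hittingAfter at h
    split_ifs at h with hex
    · have := Nat.sInf_mem (s := {i | k ≤ i ∧ w i ∈ U}) hex
      have h' : sInf {i | k ≤ i ∧ w i ∈ U} = n := WithTop.coe_injective h
      rwa [h'] at this
    · exact absurd h (WithTop.top_ne_coe)
  · rintro ⟨hn, h⟩
    unfold hittingAfter
    rw [if_pos ⟨n, hn⟩]
    congr 1
    refine le_antisymm (Nat.sInf_le hn) (le_csInf ⟨n, hn⟩ fun m hm => ?_)
    by_contra! hlt
    exact h m hm.1 hlt hm.2

/-- The trajectories that visit `C` without leaving `B` up to that visit. -/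
def hitBefore {S : Type*} (C B : Set S) : Set (ℕ → S) :=
  {w | ∃ n, w n ∈ C ∧ ∀ m ≤ n, w m ∈ B}

/-- The trajectories that leave `B` in the set `A`. -/
def exitIn {S : Type*} (B A : Set S) : Set (ℕ → S) :=
  {w | ∃ n, (w n ∉ B ∧ w n ∈ A) ∧ ∀ m < n, w m ∈ B}

theorem exists_first {P : ℕ → Prop} (h : ∃ n, P n) : ∃ n, P n ∧ ∀ m < n, ¬ P m := by
  classical
  exact ⟨Nat.find h, Nat.find_spec h, fun m hm => Nat.find_min h hm⟩

theorem hittingAfter_lt_iff {S : Type*} (U V : Set S) (k l : ℕ) (w : ℕ → S) :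
    hittingAfter (fun n (w : ℕ → S) => w n) U k w <
        hittingAfter (fun n (w : ℕ → S) => w n) V l w ↔
      ∃ n, (k ≤ n ∧ w n ∈ U) ∧ ∀ m, l ≤ m → m ≤ n → w m ∉ V := by
  constructor
  · intro h
    obtain ⟨n, hn⟩ := WithTop.ne_top_iff_exists.1 (ne_top_of_lt h)
    rw [← hn] at h
    exact ⟨n, ((hittingAfter_eq_coe_iff U k n w).1 hn.symm).1,
      (coe_lt_hittingAfter_iff V l n w).1 h⟩
  · rintro ⟨n, hn, h⟩
    obtain ⟨n', ⟨h1, h2⟩, h3⟩ := exists_first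
      (P := fun n => (k ≤ n ∧ w n ∈ U) ∧ ∀ m, l ≤ m → m ≤ n → w m ∉ V) ⟨n, hn, h⟩
    have heq : hittingAfter (fun n (w : ℕ → S) => w n) U k w = (n' : WithTop ℕ) := by
      refine (hittingAfter_eq_coe_iff U k n' w).2 ⟨h1, fun m hk hm hU => ?_⟩
      exact h3 m hm ⟨⟨hk, hU⟩, fun m' hl hm' => h2 m' hl (hm'.trans hm.le)⟩
    rw [heq]
    exact (coe_lt_hittingAfter_iff V l n' w).2 h2

theorem entranceTime_lt_exitTime_iff {S : Type*} (C B : Set S) (w : ℕ → S) :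
    entranceTime C w < exitTime B w ↔ w ∈ hitBefore C B := by
  unfold exitTime entranceTime
  rw [hittingAfter_lt_iff]
  simp [hitBefore]

theorem exitTime_lt_hitTime_iff {S : Type*} {C B : Set S} {w : ℕ → S} (h0 : w 0 ∈ B) :
    exitTime B w < hitTime C w ↔ (fun n => w (n + 1)) ∈ hitBefore Bᶜ Cᶜ := by
  unfold exitTime entranceTime hitTime
  rw [hittingAfter_lt_iff]
  constructor
  · rintro ⟨n, ⟨_, hn⟩, h⟩
    cases n with
    | zero => exact absurd h0 hn
    | succ n => exact ⟨n, hn, fun m hm => h (m + 1) (by omega) (by omega)⟩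
  · rintro ⟨n, hn, h⟩
    refine ⟨n + 1, ⟨Nat.zero_le _, hn⟩, fun m h1 h2 => ?_⟩
    obtain ⟨m, rfl⟩ := Nat.exists_eq_add_of_le' h1
    exact h m (by omega)

theorem hitTime_eq_top_iff {S : Type*} (K : Set S) (w : ℕ → S) :
    hitTime K w = ⊤ ↔ (fun n => w (n + 1)) ∉ hitBefore K Set.univ := by
  unfold hitTime
  rw [hittingAfter_eq_top_iff]
  simp only [hitBefore, Set.mem_ofPred_eq, Set.mem_univ, implies_true, and_true, not_exists]
  constructor
  · intro h n
    exact h (n + 1) (by omega)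
  · intro h n hn
    obtain ⟨m, rfl⟩ := Nat.exists_eq_add_of_le' hn
    exact h m

theorem hitBefore_shift_iff {S : Type*} {C B : Set S} {w : ℕ → S} (hB : w 0 ∈ B)
    (hC : w 0 ∉ C) : w ∈ hitBefore C B ↔ (fun n => w (n + 1)) ∈ hitBefore C B := by
  constructor
  · rintro ⟨n, hn, h⟩
    cases n with
    | zero => exact absurd hn hC
    | succ n => exact ⟨n, hn, fun m hm => h (m + 1) (by omega)⟩
  · rintro ⟨n, hn, h⟩
    refine ⟨n + 1, hn, fun m hm => ?_⟩
    cases m with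
    | zero => exact hB
    | succ m => exact h m (by omega)

theorem mem_hitBefore_of_zero {S : Type*} {C B : Set S} {w : ℕ → S} (hB : w 0 ∈ B)
    (hC : w 0 ∈ C) : w ∈ hitBefore C B :=
  ⟨0, hC, fun m hm => by rwa [Nat.le_zero.1 hm]⟩

theorem notMem_hitBefore_of_zero {S : Type*} {C B : Set S} {w : ℕ → S} (hB : w 0 ∉ B) :
    w ∉ hitBefore C B := by
  rintro ⟨n, _, h⟩
  exact hB (h 0 (Nat.zero_le n))

theorem exitIn_shift_iff {S : Type*} {B A : Set S} {w : ℕ → S} (hB : w 0 ∈ B) :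
    w ∈ exitIn B A ↔ (fun n => w (n + 1)) ∈ exitIn B A := by
  constructor
  · rintro ⟨n, hn, h⟩
    cases n with
    | zero => exact absurd hB hn.1
    | succ n => exact ⟨n, hn, fun m hm => h (m + 1) (by omega)⟩
  · rintro ⟨n, hn, h⟩
    refine ⟨n + 1, hn, fun m hm => ?_⟩
    cases m with
    | zero => exact hB
    | succ m => exact h m (by omega)

theorem exitIn_zero_iff {S : Type*} {B A : Set S} {w : ℕ → S} (hB : w 0 ∉ B) :
    w ∈ exitIn B A ↔ w 0 ∈ A := by
  constructor
  · rintro ⟨n, hn, h⟩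
    cases n with
    | zero => exact hn.2
    | succ n => exact absurd (h 0 (by omega)) hB
  · intro h
    exact ⟨0, ⟨hB, h⟩, fun m hm => absurd hm (Nat.not_lt_zero m)⟩

section measurable

variable {G : Type*} [MeasurableSpace G] [Countable G] [MeasurableSingletonClass G]

theorem measurableSet_coord_mem (n : ℕ) (U : Set G) : MeasurableSet {w : ℕ → G | w n ∈ U} :=
  measurable_pi_apply n (Set.to_countable U).measurableSet

theorem measurableSet_hitBefore (C B : Set G) : MeasurableSet (hitBefore C B) := by
  simp only [hitBefore, Set.ofPred_exists, Set.ofPred_and, Set.ofPred_forall]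
  exact MeasurableSet.iUnion fun n => (measurableSet_coord_mem n C).inter
    (MeasurableSet.iInter fun m => MeasurableSet.iInter fun _ => measurableSet_coord_mem m B)

theorem measurableSet_exitIn (B A : Set G) : MeasurableSet (exitIn B A) := by
  simp only [exitIn, Set.ofPred_exists, Set.ofPred_and, Set.ofPred_forall]
  exact MeasurableSet.iUnion fun n =>
    ((measurableSet_coord_mem n Bᶜ).inter (measurableSet_coord_mem n A)).inter
    (MeasurableSet.iInter fun m => MeasurableSet.iInter fun _ => measurableSet_coord_mem m B)

end measurable

section walk

variable {d : ℕ} {G : Type*} [AddCommGroup G] [MeasurableSpace G] [Countable G]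
  [MeasurableSingletonClass G] (s : Fin (d + 1) × Bool → G)

/-- The probability that the walk from `x` visits `C` before it leaves `B`. -/
noncomputable def hitProb (C B : Set G) (x : G) : ℝ := (walkLaw s x).real (hitBefore C B)

/-- The probability that the walk from `x` leaves `R` in the set `A`. -/
noncomputable def exitProb (R A : Set G) (x : G) : ℝ := (walkLaw s x).real (exitIn R A)

/-- The probability that the walk from `x` visits `C` before it leaves `B`, and leaves `R` in the
set `A`. -/
noncomputable def hitExitProb (C B R A : Set G) (x : G) : ℝ :=
  (walkLaw s x).real (hitBefore C B ∩ exitIn R A)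

theorem hitProb_nonneg (C B : Set G) (x : G) : 0 ≤ hitProb s C B x := measureReal_nonneg

theorem hitProb_le_one (C B : Set G) (x : G) : hitProb s C B x ≤ 1 := measureReal_le_one

theorem hitProb_of_mem {C B : Set G} {x : G} (hB : x ∈ B) (hC : x ∈ C) :
    hitProb s C B x = 1 :=
  walkLaw_real_eq_one s x (measurableSet_hitBefore C B) fun _ hw =>
    mem_hitBefore_of_zero (hw ▸ hB) (hw ▸ hC)

theorem hitProb_of_notMem {C B : Set G} {x : G} (hB : x ∉ B) : hitProb s C B x = 0 :=
  walkLaw_real_eq_zero s x (measurableSet_hitBefore C B) fun _ hw =>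
    notMem_hitBefore_of_zero (hw ▸ hB)

theorem hitProb_eq_stepAvg {C B : Set G} {x : G} (hB : x ∈ B) (hC : x ∉ C) :
    hitProb s C B x = stepAvg s (hitProb s C B) x :=
  walkLaw_real_eq_stepAvg s x (measurableSet_hitBefore C B) (measurableSet_hitBefore C B)
    fun _ hw => hitBefore_shift_iff (hw ▸ hB) (hw ▸ hC)

theorem exitProb_eq_stepAvg {R A : Set G} {x : G} (hR : x ∈ R) :
    exitProb s R A x = stepAvg s (exitProb s R A) x :=
  walkLaw_real_eq_stepAvg s x (measurableSet_exitIn R A) (measurableSet_exitIn R A)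
    fun _ hw => exitIn_shift_iff (hw ▸ hR)

theorem exitProb_of_mem {R A : Set G} {x : G} (hR : x ∉ R) (hA : x ∈ A) :
    exitProb s R A x = 1 :=
  walkLaw_real_eq_one s x (measurableSet_exitIn R A) fun _ hw =>
    (exitIn_zero_iff (hw ▸ hR)).2 (hw ▸ hA)

theorem exitProb_of_notMem {R A : Set G} {x : G} (hR : x ∉ R) (hA : x ∉ A) :
    exitProb s R A x = 0 :=
  walkLaw_real_eq_zero s x (measurableSet_exitIn R A) fun _ hw h =>
    hA (hw ▸ (exitIn_zero_iff (hw ▸ hR)).1 h)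

theorem hitExitProb_of_notMem {C B R A : Set G} {x : G} (hB : x ∉ B) :
    hitExitProb s C B R A x = 0 :=
  walkLaw_real_eq_zero s x ((measurableSet_hitBefore C B).inter (measurableSet_exitIn R A))
    fun _ hw h => notMem_hitBefore_of_zero (hw ▸ hB) h.1

theorem hitExitProb_of_mem {C B R A : Set G} {x : G} (hB : x ∈ B) (hC : x ∈ C) :
    hitExitProb s C B R A x = exitProb s R A x :=
  walkLaw_real_congr s x ((measurableSet_hitBefore C B).inter (measurableSet_exitIn R A))
    (measurableSet_exitIn R A) fun _ hw =>
      ⟨fun h => h.2, fun h => ⟨mem_hitBefore_of_zero (hw ▸ hB) (hw ▸ hC), h⟩⟩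

theorem hitExitProb_eq_stepAvg {C B R A : Set G} {x : G} (hB : x ∈ B) (hR : x ∈ R) (hC : x ∉ C) :
    hitExitProb s C B R A x = stepAvg s (hitExitProb s C B R A) x :=
  walkLaw_real_eq_stepAvg s x ((measurableSet_hitBefore C B).inter (measurableSet_exitIn R A))
    ((measurableSet_hitBefore C B).inter (measurableSet_exitIn R A))
    fun _ hw => and_congr (hitBefore_shift_iff (hw ▸ hB) (hw ▸ hC)) (exitIn_shift_iff (hw ▸ hR))

end walk

/-! ### The walk on the cylinder -/

/-- The steps of simple random walk on the cylinder. -/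
abbrev cylStep (d N : ℕ) (p : Fin (d + 1) × Bool) : Cyl d N := proj d N (unitStep d p)

instance (N : ℕ) : Countable (ZMod N) := by
  cases N with
  | zero => exact inferInstanceAs (Countable ℤ)
  | succ n => exact inferInstanceAs (Countable (Fin (n + 1)))

theorem cylStep_last (d N : ℕ) (b : Bool) :
    cylStep d N (Fin.last d, b) = (0, if b then 1 else -1) := by
  refine Prod.ext ?_ ?_
  · funext j
    simp [cylStep, proj, unitStep, Fin.castSucc_ne_last]
  · simp [cylStep, proj, unitStep]

theorem cylStep_castSucc (d N : ℕ) (j : Fin d) (b : Bool) :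
    cylStep d N (j.castSucc, b) = (Pi.single j (if b then 1 else -1), 0) := by
  refine Prod.ext ?_ ?_
  · funext i
    cases b <;> by_cases h : i = j <;>
      simp [cylStep, proj, unitStep, Pi.single_apply, h]
  · simp [cylStep, proj, unitStep, Pi.single_apply, (Fin.castSucc_ne_last j).symm]

theorem sum_cylStep {d N : ℕ} (f : Cyl d N → ℝ) (y : Torus d N) (z : ℤ) :
    ∑ p, f ((y, z) + cylStep d N p) =
      ∑ j : Fin d, (f (y + Pi.single j 1, z) + f (y + Pi.single j (-1), z)) +
        (f (y, z + 1) + f (y, z - 1)) := by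
  rw [Fintype.sum_prod_type, Fin.sum_univ_castSucc]
  simp only [Fintype.sum_bool, cylStep_last, cylStep_castSucc, Prod.mk_add_mk]
  simp [sub_eq_add_neg]

theorem cylStep_snd_mem {d N : ℕ} (p : Fin (d + 1) × Bool) :
    -1 ≤ (cylStep d N p).2 ∧ (cylStep d N p).2 ≤ 1 := by
  obtain ⟨j, b⟩ := p
  induction j using Fin.lastCases with
  | last => rw [cylStep_last]; cases b <;> simp
  | cast j => rw [cylStep_castSucc]; simp

theorem finite_block_Ioo {d N : ℕ} [NeZero N] (a b : ℤ) : (block d N (Set.Ioo a b)).Finite :=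
  (Set.finite_univ.prod (Set.finite_Ioo a b)).subset fun _ hx => ⟨trivial, hx⟩

/-- The maximum principle on a finite slab of the cylinder. -/
theorem nonpos_of_subharmonic_on_slab {d N : ℕ} [NeZero N] (η : ℕ) (ζ : ℤ) (f : Cyl d N → ℝ)
    (hoff : ∀ x, x ∉ block d N (bigInterval η ζ) → f x ≤ 0)
    (hsub : ∀ x ∈ block d N (bigInterval η ζ), 0 < f x → f x ≤ stepAvg (cylStep d N) f x)
    (x : Cyl d N) : f x ≤ 0 := by
  have hmem : ∀ x, 0 < f x → x ∈ block d N (bigInterval η ζ) := fun x hx => by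
    by_contra hn
    exact absurd (hoff x hn) (not_le.2 hx)
  refine nonpos_of_subharmonic (cylStep d N) (Fin.last d, true) ?_ f ?_ ?_ x
  · intro m n h
    have := congrArg Prod.snd h
    simpa [cylStep_last] using this
  · intro ε hε
    exact (finite_block_Ioo _ _).subset fun y hy => hmem y (lt_of_lt_of_le hε hy)
  · intro y hy
    exact stepAvg_subharmonic _ _ _ (hsub y (hmem y hy) hy)

theorem eq_zero_of_harmonic_on_slab {d N : ℕ} [NeZero N] (η : ℕ) (ζ : ℤ) (f : Cyl d N → ℝ)
    (hoff : ∀ x, x ∉ block d N (bigInterval η ζ) → f x = 0)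
    (hharm : ∀ x ∈ block d N (bigInterval η ζ), f x ≠ 0 → f x = stepAvg (cylStep d N) f x)
    (x : Cyl d N) : f x = 0 := by
  refine le_antisymm (nonpos_of_subharmonic_on_slab η ζ f (fun x hx => (hoff x hx).le)
    (fun x hx h0 => (hharm x hx h0.ne').le) x) ?_
  have := nonpos_of_subharmonic_on_slab η ζ (fun x => (-1) * f x)
    (fun x hx => by simp [hoff x hx])
    (fun x hx h0 => by
      rw [stepAvg_const_mul, ← hharm x hx]
      rintro h
      simp [h] at h0) x
  linarith

section slab

variable {d N : ℕ} {η : ℕ} {ζ : ℤ}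

theorem mem_slab_add_cylStep {x : Cyl d N} (hx : x ∈ block d N (bigInterval η ζ))
    (p : Fin (d + 1) × Bool) :
    x + cylStep d N p ∈ block d N (bigInterval η ζ) ∨ (x + cylStep d N p).2 = ζ + η ∨
      (x + cylStep d N p).2 = ζ - η := by
  have h1 := cylStep_snd_mem (N := N) p
  have h2 : ζ - η < x.2 ∧ x.2 < ζ + η := hx
  have h3 : (x + cylStep d N p).2 = x.2 + (cylStep d N p).2 := rfl
  change (ζ - η < (x + cylStep d N p).2 ∧ (x + cylStep d N p).2 < ζ + η) ∨ _
  omega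

theorem stepAvg_height (a b : ℝ) (x : Cyl d N) :
    stepAvg (cylStep d N) (fun y => a + b * (y.2 : ℝ)) x = a + b * (x.2 : ℝ) := by
  obtain ⟨y, z⟩ := x
  rw [stepAvg, sum_cylStep (fun y : Cyl d N => a + b * (y.2 : ℝ))]
  simp only [Finset.sum_const, Finset.card_univ, Fintype.card_fin, nsmul_eq_mul]
  push_cast
  field_simp
  ring

variable [NeZero N]

/-- The distribution of the exit level: the ruin probabilities of the vertical component. -/
theorem exitProb_eq (hη : 0 < η) {R : Set (Cyl d N)} (hR : block d N (bigInterval η ζ) ⊆ R)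
    (htop : ∀ y, (y, ζ + (η : ℤ)) ∉ R) (hbot : ∀ y, (y, ζ - (η : ℤ)) ∉ R) (σ : ℤ)
    (hσ : σ = 1 ∨ σ = -1) {x : Cyl d N} (hx : x ∈ block d N (bigInterval η ζ)) :
    exitProb (cylStep d N) R {y | y.2 = ζ + σ * η} x =
      (1 + σ * ((x.2 : ℝ) - ζ) / η) / 2 := by
  classical
  set q := exitProb (cylStep d N) R {y | y.2 = ζ + σ * η} with hq
  set ℓ : Cyl d N → ℝ := fun y => (1 / 2 - σ * ζ / (2 * η)) + (σ / (2 * η)) * (y.2 : ℝ) with hℓ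
  have hη' : (0 : ℝ) < η := by exact_mod_cast hη
  have hbd : ∀ y : Cyl d N, y.2 = ζ + η ∨ y.2 = ζ - η → q y = ℓ y := by
    rintro ⟨y, z⟩ hz
    have hnot : (y, z) ∉ R := by
      rcases hz with h | h
      · simp only at h; rw [h]; exact htop y
      · simp only at h; rw [h]; exact hbot y
    by_cases hA : z = ζ + σ * η
    · rw [hq, exitProb_of_mem _ hnot hA, hℓ]
      simp only [hA]
      push_cast
      rcases hσ with rfl | rfl <;> push_cast <;> field_simp <;> ring
    · rw [hq, exitProb_of_notMem _ hnot hA, hℓ]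
      have : z = ζ - σ * η := by
        rcases hσ with rfl | rfl <;> rcases hz with h | h <;> simp at h hA ⊢ <;> omega
      simp only [this]
      push_cast
      rcases hσ with rfl | rfl <;> push_cast <;> field_simp <;> ring
  have key := eq_zero_of_harmonic_on_slab η ζ
    (fun y => if y ∈ block d N (bigInterval η ζ) then q y - ℓ y else 0)
    (fun y hy => by simp only [if_neg hy]) (fun y hy _ => by
      have : stepAvg (cylStep d N)
          (fun y => if y ∈ block d N (bigInterval η ζ) then q y - ℓ y else 0) y =
          stepAvg (cylStep d N) (fun y => q y - ℓ y) y := by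
        refine stepAvg_congr _ fun p => ?_
        rcases mem_slab_add_cylStep hy p with h | h
        · simp only [if_pos h]
        · simp only [hbd _ h, sub_self, ite_self]
      rw [this, stepAvg_sub, hℓ, stepAvg_height, if_pos hy, hq, ← exitProb_eq_stepAvg _ (hR hy)]) x
  simp only [if_pos hx] at key
  rw [sub_eq_zero.1 key, hℓ]
  field_simp
  ring

theorem hitExitProb_le {C R A : Set (Cyl d N)} (hR : block d N (bigInterval η ζ) ⊆ R) (b : ℝ)
    (hb : ∀ x ∈ C, exitProb (cylStep d N) R A x ≤ b) (x : Cyl d N) :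
    hitExitProb (cylStep d N) C (block d N (bigInterval η ζ)) R A x ≤
      b * hitProb (cylStep d N) C (block d N (bigInterval η ζ)) x := by
  rw [← sub_nonpos]
  refine nonpos_of_subharmonic_on_slab η ζ (fun x =>
    hitExitProb (cylStep d N) C (block d N (bigInterval η ζ)) R A x -
      b * hitProb (cylStep d N) C (block d N (bigInterval η ζ)) x) ?_ ?_ x
  · intro y hy
    simp only [hitExitProb_of_notMem _ hy, hitProb_of_notMem _ hy]
    simp
  · intro y hy h0
    have hyC : y ∉ C := by
      intro hyC
      have := hb y hyC
      rw [hitExitProb_of_mem _ hy hyC, hitProb_of_mem _ hy hyC] at h0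
      linarith
    rw [stepAvg_sub, stepAvg_const_mul, ← hitExitProb_eq_stepAvg _ hy (hR hy) hyC,
      ← hitProb_eq_stepAvg _ hy hyC]

theorem le_hitExitProb {C R A : Set (Cyl d N)} (hR : block d N (bigInterval η ζ) ⊆ R) (b : ℝ)
    (hb : ∀ x ∈ C, b ≤ exitProb (cylStep d N) R A x) (x : Cyl d N) :
    b * hitProb (cylStep d N) C (block d N (bigInterval η ζ)) x ≤
      hitExitProb (cylStep d N) C (block d N (bigInterval η ζ)) R A x := by
  rw [← sub_nonpos]
  refine nonpos_of_subharmonic_on_slab η ζ (fun x =>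
    b * hitProb (cylStep d N) C (block d N (bigInterval η ζ)) x -
    hitExitProb (cylStep d N) C (block d N (bigInterval η ζ)) R A x) ?_ ?_ x
  · intro y hy
    simp only [hitExitProb_of_notMem _ hy, hitProb_of_notMem _ hy]
    simp
  · intro y hy h0
    have hyC : y ∉ C := by
      intro hyC
      have := hb y hyC
      rw [hitExitProb_of_mem _ hy hyC, hitProb_of_mem _ hy hyC] at h0
      linarith
    rw [stepAvg_sub, stepAvg_const_mul, ← hitExitProb_eq_stepAvg _ hy (hR hy) hyC,
      ← hitProb_eq_stepAvg _ hy hyC]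

/-- The walk leaves a slab almost surely, hence it either visits `C` first or leaves first. -/
theorem hitProb_compl {C : Set (Cyl d N)} (hC : C ⊆ block d N (bigInterval η ζ)) (x : Cyl d N) :
    hitProb (cylStep d N) (block d N (bigInterval η ζ))ᶜ Cᶜ x =
      1 - hitProb (cylStep d N) C (block d N (bigInterval η ζ)) x := by
  have key := eq_zero_of_harmonic_on_slab η ζ (fun x =>
    hitProb (cylStep d N) (block d N (bigInterval η ζ))ᶜ Cᶜ x -
      (1 - hitProb (cylStep d N) C (block d N (bigInterval η ζ)) x)) ?_ ?_ x
  · exact sub_eq_zero.1 key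
  · intro y hy
    rw [hitProb_of_mem _ (show y ∈ Cᶜ from fun h => hy (hC h)) hy, hitProb_of_notMem _ hy]
    simp
  · intro y hy h0
    have hyC : y ∉ C := by
      intro hyC
      rw [hitProb_of_notMem _ (show y ∉ Cᶜ from fun h => h hyC), hitProb_of_mem _ hy hyC] at h0
      simp at h0
    rw [stepAvg_sub, stepAvg_sub, stepAvg_const,
      ← hitProb_eq_stepAvg _ (show y ∈ Cᶜ from hyC) (show y ∉ _ᶜ from fun h => h hy),
      ← hitProb_eq_stepAvg _ hy hyC]

theorem cylLaw_real_escape {C : Set (Cyl d N)} (hC : C ⊆ block d N (bigInterval η ζ))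
    {x : Cyl d N} (hx : x ∈ C) :
    (cylLaw d N x).real {w | exitTime (block d N (bigInterval η ζ)) w < hitTime C w} =
      1 - stepAvg (cylStep d N) (hitProb (cylStep d N) C (block d N (bigInterval η ζ))) x := by
  have hmeas : MeasurableSet {w : ℕ → Cyl d N |
      exitTime (block d N (bigInterval η ζ)) w < hitTime C w} := by
    unfold exitTime entranceTime hitTime
    simp only [hittingAfter_lt_iff, Set.ofPred_exists, Set.ofPred_and, Set.ofPred_forall]
    exact MeasurableSet.iUnion fun n => ((MeasurableSet.const _).inter
      (measurableSet_coord_mem n _)).inter (MeasurableSet.iInter fun m =>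
        MeasurableSet.iInter fun _ => MeasurableSet.iInter fun _ => measurableSet_coord_mem m Cᶜ)
  rw [cylLaw, walkLaw_real_eq_stepAvg _ x hmeas
    (measurableSet_hitBefore (block d N (bigInterval η ζ))ᶜ Cᶜ)
    (fun w hw => exitTime_lt_hitTime_iff (hw ▸ hC hx))]
  have := stepAvg_congr (cylStep d N) (x := x)
    (f := hitProb (cylStep d N) (block d N (bigInterval η ζ))ᶜ Cᶜ)
    (g := fun y => 1 - hitProb (cylStep d N) C (block d N (bigInterval η ζ)) y)
    fun p => hitProb_compl hC (x + cylStep d N p)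
  rw [stepAvg_sub, stepAvg_const] at this
  exact this

end slab

/-! ### The vertical Green function and the hitting probability from a uniform level -/

theorem eq_zero_of_harmonic_on_interval (η : ℕ) (ζ : ℤ) (W : ℤ → ℝ)
    (hoff : ∀ z, z ∉ bigInterval η ζ → W z = 0)
    (hharm : ∀ z ∈ bigInterval η ζ, 2 * W z = W (z + 1) + W (z - 1)) (z : ℤ) : W z = 0 := by
  have key : ∀ W : ℤ → ℝ, (∀ z, z ∉ bigInterval η ζ → W z = 0) →
      (∀ z ∈ bigInterval η ζ, 2 * W z = W (z + 1) + W (z - 1)) → W z ≤ 0 := by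
    intro W hoff hharm
    have hmem : ∀ x, 0 < W x → x ∈ bigInterval η ζ := fun x hx => by
      by_contra hn
      exact absurd (hoff x hn) hx.ne'
    refine nonpos_of_subharmonic (fun b : Bool => if b then (1 : ℤ) else -1) true ?_ W ?_ ?_ z
    · intro m n h
      simpa using h
    · intro ε hε
      exact (Set.finite_Ioo _ _).subset fun y hy => hmem y (lt_of_lt_of_le hε hy)
    · intro y hy
      have := hharm y (hmem y hy)
      simp only [Fintype.card_bool, Fintype.sum_bool]
      simp only [if_true, Bool.false_eq_true, if_false, ← sub_eq_add_neg]
      push_cast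
      linarith
  refine le_antisymm (key W hoff hharm) ?_
  have := key (fun z => - W z) (fun z hz => by simp [hoff z hz]) (fun z hz => by
    have := hharm z hz
    linarith)
  linarith

/-- The Green function of simple random walk on `ℤ` killed outside `ζ + (-η, η)`. -/
noncomputable def intervalGreen (η : ℕ) (ζ a z : ℤ) : ℝ :=
  ((η : ℝ) + (min a z : ℤ) - ζ) * (η + ζ - (max a z : ℤ)) / η

theorem intervalGreen_laplacian {η : ℕ} (hη : 0 < η) (ζ a z : ℤ) :
    2 * intervalGreen η ζ a z - intervalGreen η ζ a (z + 1) - intervalGreen η ζ a (z - 1) =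
      if z = a then 2 else 0 := by
  have hη' : (η : ℝ) ≠ 0 := by positivity
  unfold intervalGreen
  rcases lt_trichotomy z a with h | h | h
  · rw [if_neg h.ne, min_eq_right h.le, max_eq_left h.le, min_eq_right (by omega : z + 1 ≤ a),
      max_eq_left (by omega : z + 1 ≤ a), min_eq_right (by omega : z - 1 ≤ a),
      max_eq_left (by omega : z - 1 ≤ a)]
    push_cast
    field_simp
    ring
  · rw [if_pos h, h, min_self, max_self, min_eq_left (by omega : a ≤ a + 1),
      max_eq_right (by omega : a ≤ a + 1), min_eq_right (by omega : a - 1 ≤ a),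
      max_eq_left (by omega : a - 1 ≤ a)]
    push_cast
    field_simp
    ring
  · rw [if_neg h.ne', min_eq_left h.le, max_eq_right h.le, min_eq_left (by omega : a ≤ z + 1),
      max_eq_right (by omega : a ≤ z + 1), min_eq_left (by omega : a ≤ z - 1),
      max_eq_right (by omega : a ≤ z - 1)]
    push_cast
    field_simp
    ring

theorem intervalGreen_bounds {η δ : ℕ} (hη : 0 < η) (hδ : δ ≤ η) {ζ a z : ℤ}
    (ha : a ∈ smallInterval δ ζ) (hz : z ∈ smallInterval δ ζ) :
    η * (1 - (δ : ℝ) / η) ^ 2 ≤ intervalGreen η ζ a z ∧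
      intervalGreen η ζ a z ≤ η * (1 + (δ : ℝ) / η) ^ 2 := by
  have hη' : (0 : ℝ) < η := by positivity
  have hδ' : (δ : ℝ) ≤ η := by exact_mod_cast hδ
  have ha' : ζ - δ ≤ a ∧ a ≤ ζ + δ := ha
  have hz' : ζ - δ ≤ z ∧ z ≤ ζ + δ := hz
  have h1 : ((ζ : ℝ) - δ) ≤ (min a z : ℤ) := by exact_mod_cast (le_min ha'.1 hz'.1)
  have h2 : ((min a z : ℤ) : ℝ) ≤ ζ + δ := by exact_mod_cast (min_le_left a z).trans ha'.2
  have h3 : ((max a z : ℤ) : ℝ) ≤ ζ + δ := by exact_mod_cast (max_le ha'.2 hz'.2)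
  have h4 : ((ζ : ℝ) - δ) ≤ (max a z : ℤ) := by exact_mod_cast ha'.1.trans (le_max_left a z)
  have e1 : η * (1 - (δ : ℝ) / η) ^ 2 = ((η : ℝ) - δ) * (η - δ) / η := by field_simp
  have e2 : η * (1 + (δ : ℝ) / η) ^ 2 = ((η : ℝ) + δ) * (η + δ) / η := by field_simp
  rw [e1, e2]
  unfold intervalGreen
  constructor
  · gcongr ?_ / _
    exact mul_le_mul (by linarith) (by linarith) (by linarith) (by linarith)
  · gcongr ?_ / _
    exact mul_le_mul (by linarith) (by linarith) (by linarith) (by linarith)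

section level

variable {d N : ℕ} [NeZero N] {η : ℕ} {ζ : ℤ}

theorem sum_level_shift (f : Cyl d N → ℝ) (t : Torus d N) (z : ℤ) :
    ∑ y, f (y + t, z) = ∑ y, f (y, z) :=
  Equiv.sum_comp (Equiv.addRight t) fun y => f (y, z)

/-- Summation over a level turns the walk on the cylinder into the walk on `ℤ`. -/
theorem level_laplacian (f : Cyl d N → ℝ) (z : ℤ) :
    2 * ∑ y, f (y, z) - ∑ y, f (y, z + 1) - ∑ y, f (y, z - 1) =
      2 * ((d : ℝ) + 1) * ∑ y : Torus d N, (f (y, z) - stepAvg (cylStep d N) f (y, z)) := by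
  have h : ∑ y : Torus d N, ∑ p, f ((y, z) + cylStep d N p) =
      2 * d * ∑ y, f (y, z) + (∑ y, f (y, z + 1) + ∑ y, f (y, z - 1)) := by
    have hdir : ∀ c : ZMod N, ∑ y : Torus d N, ∑ j : Fin d, f (y + Pi.single j c, z) =
        d * ∑ y, f (y, z) := by
      intro c
      rw [Finset.sum_comm]
      simp only [sum_level_shift, Finset.sum_const, Finset.card_univ, Fintype.card_fin,
        nsmul_eq_mul]
    simp only [sum_cylStep, Finset.sum_add_distrib, hdir]
    ring
  simp only [stepAvg, Finset.sum_sub_distrib, ← Finset.sum_div, h]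
  field_simp
  ring

theorem sum_level_eq (hη : 0 < η) (C : Finset (Cyl d N)) (e f : Cyl d N → ℝ)
    (hC : (C : Set (Cyl d N)) ⊆ block d N (bigInterval η ζ))
    (hoff : ∀ x, x ∉ block d N (bigInterval η ζ) → f x = 0)
    (he : ∀ x ∈ C, f x - stepAvg (cylStep d N) f x = e x)
    (hharm : ∀ x ∈ block d N (bigInterval η ζ), x ∉ C → f x = stepAvg (cylStep d N) f x)
    {z : ℤ} (hz : z ∈ bigInterval η ζ) :
    ∑ y, f (y, z) = ((d : ℝ) + 1) * ∑ x ∈ C, e x * intervalGreen η ζ x.2 z := by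
  classical
  have hη' : (η : ℝ) ≠ 0 := by positivity
  set D : ℤ → ℝ := fun z => ∑ y, f (y, z) - ((d : ℝ) + 1) *
    ∑ x ∈ C, e x * intervalGreen η ζ x.2 z with hD
  have hCz : ∀ x ∈ C, ζ - η < x.2 ∧ x.2 < ζ + η := fun x hx => hC hx
  have hout : ∀ z, z ∉ bigInterval η ζ → ∀ y, f (y, z) = 0 := fun z hz y => hoff _ hz
  have hbd : ∀ z, z = ζ + η ∨ z = ζ - η → D z = 0 := by
    intro z h
    have hz : z ∉ bigInterval η ζ := by
      rintro ⟨h1, h2⟩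
      omega
    have hg : ∑ x ∈ C, e x * intervalGreen η ζ x.2 z = 0 := by
      refine Finset.sum_eq_zero fun x hx => ?_
      have := hCz x hx
      unfold intervalGreen
      rcases h with h | h
      · rw [max_eq_right (by omega), h]
        push_cast
        ring
      · rw [min_eq_right (by omega), h]
        push_cast
        ring
    simp only [hD, hg, hout z hz]
    simp
  have hlap : ∀ z ∈ bigInterval η ζ, 2 * D z - D (z + 1) - D (z - 1) = 0 := by
    intro z hz
    have h1 := level_laplacian f z
    have h2 : ∑ y : Torus d N, (f (y, z) - stepAvg (cylStep d N) f (y, z)) =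
        ∑ x ∈ C, if z = x.2 then e x else 0 := by
      have h3 : ∀ y : Torus d N, f (y, z) - stepAvg (cylStep d N) f (y, z) =
          ∑ x ∈ C, if x = (y, z) then e x else 0 := by
        intro y
        rw [Finset.sum_ite_eq']
        split_ifs with h
        · exact he _ h
        · exact sub_eq_zero.2 (hharm _ hz h)
      simp only [h3]
      rw [Finset.sum_comm]
      refine Finset.sum_congr rfl fun x _ => ?_
      obtain ⟨y', z'⟩ := x
      by_cases h : z = z'
      · subst h
        simp
      · simp [h, Ne.symm h]
    have h4 : ∀ x ∈ C, e x * (2 * intervalGreen η ζ x.2 z - intervalGreen η ζ x.2 (z + 1) -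
        intervalGreen η ζ x.2 (z - 1)) = 2 * if z = x.2 then e x else 0 := by
      intro x _
      rw [intervalGreen_laplacian hη]
      split_ifs <;> ring
    have h5 := Finset.sum_congr rfl h4
    rw [← Finset.mul_sum] at h5
    simp only [mul_sub, Finset.sum_sub_distrib] at h5
    have h6 : ∑ x ∈ C, e x * (2 * intervalGreen η ζ x.2 z) =
        2 * ∑ x ∈ C, e x * intervalGreen η ζ x.2 z := by
      rw [Finset.mul_sum]
      exact Finset.sum_congr rfl fun x _ => by ring
    rw [h6] at h5
    simp only [hD]
    rw [h2] at h1
    linear_combination h1 - ((d : ℝ) + 1) * h5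
  have key := eq_zero_of_harmonic_on_interval η ζ
    (fun z => if z ∈ bigInterval η ζ then D z else 0) (fun z hz => if_neg hz)
    (fun z hz => by
      have hW : ∀ z', z' = z + 1 ∨ z' = z - 1 →
          (if z' ∈ bigInterval η ζ then D z' else 0) = D z' := by
        intro z' hz'
        split_ifs with h
        · rfl
        · refine (hbd z' ?_).symm
          have h1 : ζ - η < z ∧ z < ζ + η := hz
          have h2 : ¬ (ζ - η < z' ∧ z' < ζ + η) := h
          omega
      simp only [hW (z + 1) (Or.inl rfl), hW (z - 1) (Or.inr rfl), if_pos hz]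
      linarith [hlap z hz]) z
  simp only [if_pos hz] at key
  exact sub_eq_zero.1 key

theorem sum_level_hitProb (hη : 0 < η) (C : Finset (Cyl d N))
    (hC : (C : Set (Cyl d N)) ⊆ block d N (bigInterval η ζ))
    {z : ℤ} (hz : z ∈ bigInterval η ζ) :
    ∑ y, hitProb (cylStep d N) (C : Set (Cyl d N)) (block d N (bigInterval η ζ)) (y, z) =
      ((d : ℝ) + 1) * ∑ x ∈ C, (cylLaw d N x).real {w | exitTime (block d N (bigInterval η ζ)) w <
        hitTime (C : Set (Cyl d N)) w} * intervalGreen η ζ x.2 z := by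
  refine sum_level_eq hη C _ _ hC (fun x hx => hitProb_of_notMem _ hx) (fun x hx => ?_)
    (fun x hx hxC => hitProb_eq_stepAvg _ hx hxC) hz
  rw [cylLaw_real_escape hC hx, hitProb_of_mem _ (hC hx) hx]

theorem sum_level_hitProb_bounds {δ : ℕ} (hη : 0 < η) (hδ : δ < η) (C : Finset (Cyl d N))
    (hC : (C : Set (Cyl d N)) ⊆ block d N (smallInterval δ ζ))
    {z : ℤ} (hz : z ∈ smallInterval δ ζ) :
    ((d : ℝ) + 1) * (η * (1 - (δ : ℝ) / η) ^ 2) * cylCap (block d N (bigInterval η ζ)) C ≤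
      ∑ y, hitProb (cylStep d N) (C : Set (Cyl d N)) (block d N (bigInterval η ζ)) (y, z) ∧
    ∑ y, hitProb (cylStep d N) (C : Set (Cyl d N)) (block d N (bigInterval η ζ)) (y, z) ≤
      ((d : ℝ) + 1) * (η * (1 + (δ : ℝ) / η) ^ 2) * cylCap (block d N (bigInterval η ζ)) C := by
  have hsub : smallInterval δ ζ ⊆ bigInterval η ζ := by
    rintro a ⟨h1, h2⟩
    constructor <;> omega
  have hmul : ∀ a : ℝ, ((d : ℝ) + 1) * a * cylCap (block d N (bigInterval η ζ)) C =
      ((d : ℝ) + 1) * ∑ x ∈ C, (cylLaw d N x).real {w | exitTime (block d N (bigInterval η ζ)) w <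
        hitTime (C : Set (Cyl d N)) w} * a := by
    intro a
    rw [cylCap, ← Finset.sum_mul]
    ring
  rw [sum_level_hitProb hη C (fun x hx => hsub (hC hx)) (hsub hz), hmul, hmul]
  constructor
  · refine mul_le_mul_of_nonneg_left (Finset.sum_le_sum fun x hx => ?_) (by positivity)
    exact mul_le_mul_of_nonneg_left (intervalGreen_bounds hη hδ.le (hC hx) hz).1 measureReal_nonneg
  · refine mul_le_mul_of_nonneg_left (Finset.sum_le_sum fun x hx => ?_) (by positivity)
    exact mul_le_mul_of_nonneg_left (intervalGreen_bounds hη hδ.le (hC hx) hz).2 measureReal_nonneg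

end level

/-! ### The excursion law -/

theorem walkLaw_ae_zero {d : ℕ} {G : Type*} [AddCommGroup G] [MeasurableSpace G] [Countable G]
    [MeasurableSingletonClass G] (s : Fin (d + 1) × Bool → G) (x : G) :
    ∀ᵐ w ∂(walkLaw s x), w 0 = x := by
  have hm := measurableSet_coord_mem (G := G) 0 {x}
  have h := walkLaw_real_eq_one s x hm fun w hw => hw
  rw [measureReal_def, ENNReal.toReal_eq_one_iff] at h
  exact (prob_compl_eq_zero_iff hm).2 h

theorem levelLaw_ae_zero {d N : ℕ} [NeZero N] (z : ℤ) :
    ∀ᵐ w ∂(levelLaw d N z), (w 0).2 = z := by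
  refine Measure.ae_smul_measure ?_ _
  rw [Measure.ae_sum_iff]
  intro y
  filter_upwards [walkLaw_ae_zero (cylStep d N) (y, z)] with w hw
  rw [hw]

theorem levelLaw_real {d N : ℕ} [NeZero N] (z : ℤ) {A : Set (ℕ → Cyl d N)}
    (hA : MeasurableSet A) :
    (levelLaw d N z).real A = (∑ y, (cylLaw d N (y, z)).real A) / (N : ℝ) ^ d := by
  have : ∀ y : Torus d N, IsProbabilityMeasure (cylLaw d N (y, z)) := fun y => by
    unfold cylLaw; infer_instance
  rw [measureReal_def, levelLaw, Measure.smul_apply, Measure.sum_apply _ hA, tsum_fintype,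
    smul_eq_mul, ENNReal.toReal_mul, ENNReal.toReal_sum fun y _ => measure_ne_top _ _]
  simp [measureReal_def, div_eq_inv_mul]

section grid

variable {d N L : ℕ} {δ η : ℕ} (ζ : Fin L → ℤ) (l : Fin L)

theorem block_subset_departureRegion :
    block d N (bigInterval η (ζ l)) ⊆ departureRegion d N η ζ := fun _ hx =>
  Set.mem_iUnion₂.2 ⟨ζ l, Or.inl ⟨l, rfl⟩, hx⟩

theorem notMem_departureRegion (hsep : ∀ m, m ≠ l → 2 * (η : ℤ) ≤ |ζ m - ζ l|) {x : Cyl d N}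
    (hx : x.2 = ζ l + η ∨ x.2 = ζ l - η) : x ∉ departureRegion d N η ζ := by
  intro h
  obtain ⟨g, hg, h1, h2⟩ := Set.mem_iUnion₂.1 h
  have hgl : g = ζ l ∨ 2 * (η : ℤ) ≤ |g - ζ l| := by
    rcases hg with ⟨m, rfl⟩ | ⟨_, hg⟩
    · by_cases hm : m = l
      · exact Or.inl (by rw [hm])
      · exact Or.inr (hsep m hm)
    · exact Or.inr (hg l)
  rcases hgl with rfl | hgl
  · omega
  · rcases le_abs.1 hgl with h3 | h3 <;> omega

theorem firstDeparture_eq {z : ℤ} (hz : z ∈ smallInterval δ (ζ l)) {w : ℕ → Cyl d N}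
    (hw : (w 0).2 = z) :
    firstDeparture d N δ η ζ w = exitTime (departureRegion d N η ζ) w := by
  have h0 : firstReturn d N δ η ζ w = ((0 : ℕ) : WithTop ℕ) := by
    refine (hittingAfter_eq_coe_iff _ 0 0 w).2
      ⟨⟨le_rfl, Set.mem_iUnion₂.2 ⟨ζ l, Or.inl ⟨l, rfl⟩, ?_⟩⟩, fun m _ hm => absurd hm (by omega)⟩
    rw [hw]
    exact hz
  unfold firstDeparture
  rw [h0]
  simp

theorem firstDeparture_event_iff {z z' : ℤ} (hz : z ∈ smallInterval δ (ζ l)) {w : ℕ → Cyl d N}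
    (hw : (w 0).2 = z) :
    (∃ n : ℕ, firstDeparture d N δ η ζ w = (n : WithTop ℕ) ∧ (w n).2 = z') ↔
      w ∈ exitIn (departureRegion d N η ζ) {x | x.2 = z'} := by
  rw [firstDeparture_eq ζ l hz hw]
  refine exists_congr fun n => ?_
  have := hittingAfter_eq_coe_iff (departureRegion d N η ζ)ᶜ 0 n w
  unfold exitTime entranceTime
  erw [this]
  simp only [zero_le, true_and, true_implies, Set.mem_compl_iff, not_not, Set.mem_ofPred_eq]
  tauto

theorem excursionLaw_real [NeZero N] {z z' : ℤ} (hz : z ∈ smallInterval δ (ζ l))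
    (C B : Set (Cyl d N)) :
    (excursionLaw d N δ η ζ z z').real {X | entranceTime C X < exitTime B X} =
      (∑ y, hitExitProb (cylStep d N) C B (departureRegion d N η ζ) {x | x.2 = z'} (y, z)) /
        ∑ y, exitProb (cylStep d N) (departureRegion d N η ζ) {x | x.2 = z'} (y, z) := by
  have hN : ((N : ℝ) ^ d) ≠ 0 := pow_ne_zero _ (Nat.cast_ne_zero.2 (NeZero.ne N))
  have hT : {X : ℕ → Cyl d N | entranceTime C X < exitTime B X} = hitBefore C B := by
    ext X
    exact entranceTime_lt_exitTime_iff C B X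
  have hE : {w : ℕ → Cyl d N | ∃ n : ℕ, firstDeparture d N δ η ζ w = (n : WithTop ℕ) ∧
      (w n).2 = z'} =ᵐ[levelLaw d N z] exitIn (departureRegion d N η ζ) {x | x.2 = z'} := by
    filter_upwards [levelLaw_ae_zero (d := d) z] with w hw
    exact propext (firstDeparture_event_iff ζ l hz hw)
  have hm1 := measurableSet_exitIn (departureRegion d N η ζ) {x : Cyl d N | x.2 = z'}
  have hm2 := measurableSet_hitBefore C B
  have hE2 := measure_congr (hE.inter (ae_eq_refl (hitBefore C B)))
  rw [hT, measureReal_def, excursionLaw, cond_apply' hm2, measure_congr hE, hE2, ENNReal.toReal_mul, ENNReal.toReal_inv,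
    Set.inter_comm]
  rw [← measureReal_def, ← measureReal_def, levelLaw_real z hm1, levelLaw_real z (hm2.inter hm1)]
  change (_ / _)⁻¹ * ((∑ y, hitExitProb (cylStep d N) C B (departureRegion d N η ζ)
    {x | x.2 = z'} (y, z)) / _) = _
  change ((∑ y, exitProb (cylStep d N) (departureRegion d N η ζ) {x | x.2 = z'} (y, z)) / _)⁻¹ * _
    = _
  rw [inv_div, div_mul_div_comm, mul_comm, mul_div_mul_right _ _ hN]

theorem abs_ratio_sub_le {ε D β U V W : ℝ} (hε0 : 0 ≤ ε) (hε : ε ≤ 1 / 2) (hD : 0 < D)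
    (hβ1 : (1 - ε) / 2 ≤ β) (hβ2 : β ≤ (1 + ε) / 2) (hU1 : (1 - ε) / 2 * V ≤ U)
    (hU2 : U ≤ (1 + ε) / 2 * V) (hV1 : (1 - ε) ^ 2 * W ≤ V) (hV2 : V ≤ (1 + ε) ^ 2 * W)
    (hW : 0 ≤ W) : |U / (D * β) - W / D| ≤ 20 * ε * (W / D) := by
  have hβ : 0 < β := by linarith
  have e : U / (D * β) - W / D = (U / β - W) / D := by field_simp
  rw [e, abs_div, abs_of_pos hD, ← mul_div_assoc]
  gcongr
  have hlow : (1 - ε) ^ 3 / 2 * W ≤ U := by nlinarith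
  have hup : U ≤ (1 + ε) ^ 3 / 2 * W := by nlinarith
  rw [abs_sub_le_iff]
  constructor
  · rw [sub_le_iff_le_add, div_le_iff₀ hβ]
    refine hup.trans ?_
    have h1 : (1 + ε) ^ 3 / 2 ≤ (20 * ε + 1) * ((1 - ε) / 2) := by nlinarith [mul_nonneg hε0 hε0]
    have h2 : (20 * ε + 1) * ((1 - ε) / 2) ≤ (20 * ε + 1) * β := by gcongr
    nlinarith [mul_le_mul_of_nonneg_right (h1.trans h2) hW]
  · rw [sub_le_comm, le_div_iff₀ hβ]
    refine le_trans ?_ hlow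
    rcases le_total (1 - 20 * ε) 0 with h | h
    · have h1 : (W - 20 * ε * W) * β ≤ 0 := by
        have : W - 20 * ε * W = (1 - 20 * ε) * W := by ring
        rw [this]
        exact mul_nonpos_of_nonpos_of_nonneg (mul_nonpos_of_nonpos_of_nonneg h hW) hβ.le
      refine h1.trans ?_
      have : 0 ≤ 1 - ε := by linarith
      positivity
    · have h1 : (1 - 20 * ε) * ((1 + ε) / 2) ≤ (1 - ε) ^ 3 / 2 := by
        nlinarith [mul_nonneg hε0 hε0, pow_nonneg hε0 3]
      have h2 : (1 - 20 * ε) * β ≤ (1 - 20 * ε) * ((1 + ε) / 2) := by gcongr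
      nlinarith [mul_le_mul_of_nonneg_right (h2.trans h1) hW]

/-- The probability to visit `C` for the walk started uniformly on a level near the centre of the
slab and conditioned on its exit level. -/
theorem excursionLaw_real_approx [NeZero N] (hη : 0 < η) (hδ : 2 * δ ≤ η)
    (hsep : ∀ m, m ≠ l → 2 * (η : ℤ) ≤ |ζ m - ζ l|) (C : Finset (Cyl d N))
    (hC : (C : Set (Cyl d N)) ⊆ block d N (smallInterval δ (ζ l))) {z₁ z₂ : ℤ}
    (hz₁ : z₁ ∈ innerBdry (smallInterval δ (ζ l))) (hz₂ : z₂ ∈ bdry (bigInterval η (ζ l))) :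
    ∃ Ψ : ℝ, |Ψ| ≤ 20 * ((δ : ℝ) / η) ∧
      (excursionLaw d N δ η ζ z₁ z₂).real
          {X | entranceTime (C : Set (Cyl d N)) X < exitTime (block d N (bigInterval η (ζ l))) X} =
        ((d : ℝ) + 1) * ((η : ℝ) / (N : ℝ) ^ d) *
          cylCap (block d N (bigInterval η (ζ l))) C * (1 + Ψ) := by
  obtain ⟨hz₁, -⟩ := hz₁
  have hη' : (0 : ℝ) < η := by exact_mod_cast hη
  have hN : (0 : ℝ) < (N : ℝ) ^ d := pow_pos (Nat.cast_pos.2 (NeZero.pos N)) _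
  set ε : ℝ := (δ : ℝ) / η with hε
  have hε0 : 0 ≤ ε := by positivity
  have hε2 : ε ≤ 1 / 2 := by
    rw [hε, div_le_iff₀ hη']
    have : (2 * δ : ℝ) ≤ η := by exact_mod_cast hδ
    linarith
  obtain ⟨σ, hσ, rfl⟩ : ∃ σ : ℤ, (σ = 1 ∨ σ = -1) ∧ z₂ = ζ l + σ * η := by
    obtain ⟨h1, z', ⟨h2, h3⟩, h4⟩ := hz₂
    have h5 : ¬ (ζ l - η < z₂ ∧ z₂ < ζ l + η) := h1
    rcases (abs_eq (zero_le_one)).1 h4 with h | h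
    · exact ⟨1, Or.inl rfl, by omega⟩
    · exact ⟨-1, Or.inr rfl, by omega⟩
  have hsub : smallInterval δ (ζ l) ⊆ bigInterval η (ζ l) := by
    rintro a ⟨h1, h2⟩
    constructor <;> omega
  have hR := block_subset_departureRegion (d := d) (N := N) (η := η) ζ l
  have hexit : ∀ x ∈ block d N (bigInterval η (ζ l)),
      exitProb (cylStep d N) (departureRegion d N η ζ) {y | y.2 = ζ l + σ * η} x =
        (1 + σ * ((x.2 : ℝ) - ζ l) / η) / 2 := fun x hx =>
    exitProb_eq hη hR (fun y => notMem_departureRegion ζ l hsep (Or.inl rfl))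
      (fun y => notMem_departureRegion ζ l hsep (Or.inr rfl)) σ hσ hx
  have hbound : ∀ z ∈ smallInterval δ (ζ l), (1 - ε) / 2 ≤ (1 + σ * ((z : ℝ) - ζ l) / η) / 2 ∧
      (1 + σ * ((z : ℝ) - ζ l) / η) / 2 ≤ (1 + ε) / 2 := by
    rintro z ⟨h1, h2⟩
    have h1' : (ζ l : ℝ) - δ ≤ z := by exact_mod_cast h1
    have h2' : (z : ℝ) ≤ ζ l + δ := by exact_mod_cast h2
    have h3 : -ε ≤ σ * ((z : ℝ) - ζ l) / η ∧ σ * ((z : ℝ) - ζ l) / η ≤ ε := by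
      rw [hε, ← neg_div]
      rcases hσ with rfl | rfl <;> push_cast <;> constructor <;>
        exact div_le_div_of_nonneg_right (by linarith) hη'.le
    constructor <;> linarith
  set β : ℝ := (1 + σ * ((z₁ : ℝ) - ζ l) / η) / 2 with hβ
  have hden : ∑ y : Torus d N, exitProb (cylStep d N) (departureRegion d N η ζ)
      {y | y.2 = ζ l + σ * η} (y, z₁) = (N : ℝ) ^ d * β := by
    rw [Finset.sum_congr rfl fun y _ => hexit (y, z₁) (hsub hz₁)]
    simp [hβ]
  have hU1 : (1 - ε) / 2 * ∑ y : Torus d N, hitProb (cylStep d N) (C : Set (Cyl d N))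
      (block d N (bigInterval η (ζ l))) (y, z₁) ≤ ∑ y, hitExitProb (cylStep d N) C
        (block d N (bigInterval η (ζ l))) (departureRegion d N η ζ)
        {y | y.2 = ζ l + σ * η} (y, z₁) := by
    rw [Finset.mul_sum]
    refine Finset.sum_le_sum fun y _ => le_hitExitProb hR _ (fun x hx => ?_) _
    rw [hexit x (hsub (hC hx))]
    exact (hbound _ (hC hx)).1
  have hU2 : ∑ y : Torus d N, hitExitProb (cylStep d N) C
        (block d N (bigInterval η (ζ l))) (departureRegion d N η ζ)
        {y | y.2 = ζ l + σ * η} (y, z₁) ≤ (1 + ε) / 2 * ∑ y : Torus d N,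
        hitProb (cylStep d N) (C : Set (Cyl d N)) (block d N (bigInterval η (ζ l))) (y, z₁) := by
    rw [Finset.mul_sum]
    refine Finset.sum_le_sum fun y _ => hitExitProb_le hR _ (fun x hx => ?_) _
    rw [hexit x (hsub (hC hx))]
    exact (hbound _ (hC hx)).2
  have hV := sum_level_hitProb_bounds hη (by omega : δ < η) C hC hz₁
  rw [← hε] at hV
  have hcap : 0 ≤ cylCap (block d N (bigInterval η (ζ l))) C :=
    Finset.sum_nonneg fun _ _ => measureReal_nonneg
  set c := cylCap (block d N (bigInterval η (ζ l))) C with hc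
  have hW : 0 ≤ ((d : ℝ) + 1) * η * c := by positivity
  have main := abs_ratio_sub_le (W := ((d : ℝ) + 1) * η * c) hε0 hε2 hN (hbound _ hz₁).1
    (hbound _ hz₁).2 hU1 hU2 (le_trans (le_of_eq (by ring)) hV.1)
    (hV.2.trans (le_of_eq (by ring))) hW
  rw [excursionLaw_real ζ l hz₁, hden]
  set P := (∑ y : Torus d N, hitExitProb (cylStep d N) C
        (block d N (bigInterval η (ζ l))) (departureRegion d N η ζ)
        {y | y.2 = ζ l + σ * η} (y, z₁)) / ((N : ℝ) ^ d * β) with hP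
  have hK : ((d : ℝ) + 1) * ((η : ℝ) / (N : ℝ) ^ d) * c = ((d : ℝ) + 1) * η * c / (N : ℝ) ^ d := by
    ring
  rw [hK]
  set κ := ((d : ℝ) + 1) * η * c / (N : ℝ) ^ d with hκ
  have hκ0 : 0 ≤ κ := by positivity
  rcases hκ0.eq_or_lt with h0 | h0
  · refine ⟨0, by simpa using by positivity, ?_⟩
    rw [← h0] at main ⊢
    rw [mul_zero, sub_zero] at main
    simpa using le_antisymm main (abs_nonneg _)
  · refine ⟨P / κ - 1, ?_, by field_simp; ring⟩
    have : P / κ - 1 = (P - κ) / κ := by field_simp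
    rw [this, abs_div, abs_of_pos h0, div_le_iff₀ h0]
    exact main

end grid

/-! ### Cubic expansion of powers -/

theorem exists_rpow_le_cubic (a : ℝ) : ∃ r > 0, ∃ C ≥ 0, ∀ t : ℝ, |t| ≤ r →
    (1 + t) ^ a ≤ 1 + a * t + a * (a - 1) / 2 * t ^ 2 + a * (a - 1) * (a - 2) / 6 * t ^ 3 +
      C * t ^ 4 := by
  have h := (Real.one_add_rpow_hasFPowerSeriesAt_zero (a := a)).isBigO_sub_partialSum_pow 4
  obtain ⟨C, hC, h⟩ := h.exists_nonneg
  rw [IsBigOWith, Metric.eventually_nhds_iff] at h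
  obtain ⟨r, hr, h⟩ := h
  refine ⟨r / 2, by positivity, C, hC, fun t ht => ?_⟩
  have h1 := h (y := t) (by rw [Real.dist_eq, sub_zero]; linarith)
  have e2 : Ring.choose a 2 = a * (a - 1) / 2 := by
    simp only [Ring.choose_eq_smul, Polynomial.descPochhammer_smeval_eq_ascPochhammer,
      Polynomial.ascPochhammer_smeval_cast, Polynomial.ascPochhammer_smeval_eq_eval,
      ascPochhammer_succ_eval, ascPochhammer_zero, Polynomial.eval_one]
    norm_num [Nat.factorial]
    ring
  have e3 : Ring.choose a 3 = a * (a - 1) * (a - 2) / 6 := by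
    simp only [Ring.choose_eq_smul, Polynomial.descPochhammer_smeval_eq_ascPochhammer,
      Polynomial.ascPochhammer_smeval_cast, Polynomial.ascPochhammer_smeval_eq_eval,
      ascPochhammer_succ_eval, ascPochhammer_zero, Polynomial.eval_one]
    norm_num [Nat.factorial]
    ring
  have h2 : (binomialSeries ℝ a).partialSum 4 t = 1 + a * t + a * (a - 1) / 2 * t ^ 2 +
      a * (a - 1) * (a - 2) / 6 * t ^ 3 := by
    simp [FormalMultilinearSeries.partialSum, Finset.sum_range_succ, binomialSeries,
      FormalMultilinearSeries.ofScalars, e2, e3]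
  rw [h2, zero_add, Real.norm_eq_abs] at h1
  have h3 : ‖‖t‖ ^ 4‖ = t ^ 4 := by
    rw [Real.norm_eq_abs, abs_of_nonneg (by positivity), Real.norm_eq_abs]
    exact Even.pow_abs (by decide) t
  rw [h3] at h1
  linarith [le_abs_self ((1 + t) ^ a - (1 + a * t + a * (a - 1) / 2 * t ^ 2 +
      a * (a - 1) * (a - 2) / 6 * t ^ 3))]

/-! ### A superharmonic function -/

theorem pair_bound {r C A Q q b u v : ℝ} {α : ℝ} (hα : 0 < α) (hr : 0 < r) (hr1 : r ≤ 1 / 2)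
    (hC : 0 ≤ C)
    (hexp : ∀ t : ℝ, |t| ≤ r → (1 + t) ^ (-α) ≤ 1 + (-α) * t + (-α) * (-α - 1) / 2 * t ^ 2 +
      (-α) * (-α - 1) * (-α - 2) / 6 * t ^ 3 + C * t ^ 4)
    (hA : 1 ≤ A) (hAr : 8 / r ^ 2 ≤ A) (hq : 0 ≤ q) (hQ : A + q ≤ Q)
    (h1 : 2 - 4 * b ≤ u + v) (h2 : u ^ 2 + v ^ 2 ≤ 8 * q + 2)
    (h3 : -3 * (8 * q + 2) ≤ u ^ 3 + v ^ 3) :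
    (Q + u) ^ (-α) + (Q + v) ^ (-α) ≤ Q ^ (-α) * (2 - α * (2 - 4 * b) / Q +
      (α * (α + 1) / 2 + α * (α + 1) * (α + 2) / 2 / Q + 8 * C / Q) * (8 * q + 2) / Q ^ 2) := by
  have hQ0 : 0 < Q := by linarith
  have hq8 : 8 * q + 2 ≤ 8 * Q := by linarith
  have hsmall : ∀ x : ℝ, x ^ 2 ≤ 8 * q + 2 → |x / Q| ≤ r := by
    intro x hx
    have h : (x / Q) ^ 2 ≤ r ^ 2 := by
      rw [div_pow, div_le_iff₀ (by positivity)]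
      have h4 : 8 ≤ A * r ^ 2 := by rwa [div_le_iff₀ (by positivity)] at hAr
      have h5 : A * r ^ 2 ≤ Q * r ^ 2 := by gcongr; linarith
      have h6 := mul_le_mul_of_nonneg_right (h4.trans h5) hQ0.le
      linarith
    exact abs_le_of_sq_le_sq h hr.le
  have hu := hsmall u (by linarith [sq_nonneg v])
  have hv := hsmall v (by linarith [sq_nonneg u])
  have hsplit : ∀ x : ℝ, |x / Q| ≤ r → (Q + x) ^ (-α) = Q ^ (-α) * (1 + x / Q) ^ (-α) := by
    intro x hx
    rw [← Real.mul_rpow hQ0.le (by linarith [(abs_le.1 hx).1])]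
    congr 1
    field_simp
  rw [hsplit u hu, hsplit v hv, ← mul_add]
  refine mul_le_mul_of_nonneg_left ?_ (Real.rpow_nonneg hQ0.le _)
  refine (add_le_add (hexp _ hu) (hexp _ hv)).trans ?_
  have e1 : α * (2 - 4 * b) / Q ≤ α * (u / Q + v / Q) := by
    rw [← add_div, ← mul_div_assoc]
    gcongr
  have e2 : (u / Q) ^ 2 + (v / Q) ^ 2 ≤ (8 * q + 2) / Q ^ 2 := by
    rw [div_pow, div_pow, ← add_div]
    gcongr
  have e3 : -3 * (8 * q + 2) / Q ^ 3 ≤ (u / Q) ^ 3 + (v / Q) ^ 3 := by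
    rw [div_pow, div_pow, ← add_div]
    gcongr
  have e4 : (u / Q) ^ 4 + (v / Q) ^ 4 ≤ 8 * (8 * q + 2) / Q ^ 3 := by
    have h5 : u ^ 4 + v ^ 4 ≤ (8 * q + 2) * (8 * Q) := by
      have : u ^ 4 + v ^ 4 ≤ (u ^ 2 + v ^ 2) ^ 2 := by linarith [sq_nonneg (u * v)]
      refine this.trans ?_
      rw [sq]
      exact mul_le_mul h2 (h2.trans hq8) (by positivity) (by positivity)
    rw [div_pow, div_pow, ← add_div, div_le_div_iff₀ (by positivity) (by positivity)]
    calc (u ^ 4 + v ^ 4) * Q ^ 3 ≤ ((8 * q + 2) * (8 * Q)) * Q ^ 3 := by gcongr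
      _ = 8 * (8 * q + 2) * Q ^ 4 := by ring
  have f2 := mul_le_mul_of_nonneg_left e2 (show 0 ≤ α * (α + 1) / 2 by positivity)
  have f3 := mul_le_mul_of_nonneg_left e3 (show 0 ≤ α * (α + 1) * (α + 2) / 6 by positivity)
  have f4 := mul_le_mul_of_nonneg_left e4 hC
  have e5 : (α * (α + 1) / 2 + α * (α + 1) * (α + 2) / 2 / Q + 8 * C / Q) * (8 * q + 2) / Q ^ 2 =
      α * (α + 1) / 2 * ((8 * q + 2) / Q ^ 2) -
        α * (α + 1) * (α + 2) / 6 * (-3 * (8 * q + 2) / Q ^ 3) +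
        C * (8 * (8 * q + 2) / Q ^ 3) := by
    field_simp
    ring
  rw [e5]
  linarith

/-- For a suitable constant `A`, the function `(A + |u|²)^(-(d-1)/2)` is superharmonic, with an
error term for perturbations of the squares of the coordinates. -/
theorem exists_superharmonic_const (d : ℕ) (hd : 2 ≤ d) : ∃ A : ℝ, 1 ≤ A ∧
    ∀ (q b : Fin (d + 1) → ℝ) (Δ : Fin (d + 1) × Bool → ℝ), (∀ j, 0 ≤ q j) →
      (∀ j, 2 - 4 * b j ≤ Δ (j, true) + Δ (j, false)) →
      (∀ j, Δ (j, true) ^ 2 + Δ (j, false) ^ 2 ≤ 8 * q j + 2) →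
      (∀ j, -3 * (8 * q j + 2) ≤ Δ (j, true) ^ 3 + Δ (j, false) ^ 3) →
      ∑ p, (A + ∑ j, q j + Δ p) ^ (-(((d : ℝ) - 1) / 2)) ≤
        (A + ∑ j, q j) ^ (-(((d : ℝ) - 1) / 2)) *
          (2 * ((d : ℝ) + 1) + 2 * ((d : ℝ) - 1) * (∑ j, b j) / (A + ∑ j, q j)) := by
  set α : ℝ := ((d : ℝ) - 1) / 2 with hα
  have hd' : (2 : ℝ) ≤ d := by exact_mod_cast hd
  have hα0 : 1 / 2 ≤ α := by rw [hα]; linarith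
  obtain ⟨r', hr', C, hC, hexp⟩ := exists_rpow_le_cubic (-α)
  set r := min r' (1 / 2) with hr
  have hr0 : 0 < r := lt_min hr' (by norm_num)
  set A : ℝ := 8 / r ^ 2 + (d + 1) + (α * (α + 1) * (α + 2) * 4 + 64 * C) with hA
  have hA1 : 8 / r ^ 2 ≤ A := by
    have : 0 ≤ α * (α + 1) * (α + 2) * 4 + 64 * C := by positivity
    rw [hA]; linarith
  have hA2 : (d : ℝ) + 1 + (α * (α + 1) * (α + 2) * 4 + 64 * C) ≤ A := by
    have : 0 ≤ 8 / r ^ 2 := by positivity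
    rw [hA]; linarith
  have hA3 : (d : ℝ) + 1 ≤ A := by
    have : 0 ≤ α * (α + 1) * (α + 2) * 4 + 64 * C := by positivity
    linarith
  refine ⟨A, by linarith, fun q b Δ hq h1 h2 h3 => ?_⟩
  set Q := A + ∑ j, q j with hQ
  have hQA : A ≤ Q := by
    have : 0 ≤ ∑ j, q j := Finset.sum_nonneg fun j _ => hq j
    linarith
  have hQ0 : 0 < Q := by linarith
  have hpair : ∀ j, (Q + Δ (j, true)) ^ (-α) + (Q + Δ (j, false)) ^ (-α) ≤
      Q ^ (-α) * (2 - α * (2 - 4 * b j) / Q +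
      (α * (α + 1) / 2 + α * (α + 1) * (α + 2) / 2 / Q + 8 * C / Q) *
        (8 * q j + 2) / Q ^ 2) := by
    intro j
    refine pair_bound (A := A) (by linarith) hr0 (min_le_right _ _) hC
      (fun t ht => hexp t (ht.trans (min_le_left _ _))) (by linarith) hA1 (hq j) ?_ (h1 j) (h2 j)
      (h3 j)
    have := Finset.single_le_sum (f := q) (fun i _ => hq i) (Finset.mem_univ j)
    linarith
  rw [Fintype.sum_prod_type]
  simp only [Fintype.sum_bool]
  refine (Finset.sum_le_sum fun j _ => hpair j).trans ?_
  rw [← Finset.mul_sum]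
  refine mul_le_mul_of_nonneg_left ?_ (Real.rpow_nonneg hQ0.le _)
  set k := α * (α + 1) / 2 + α * (α + 1) * (α + 2) / 2 / Q + 8 * C / Q with hk
  have hs : ∑ j, (2 - α * (2 - 4 * b j) / Q + k * (8 * q j + 2) / Q ^ 2) =
      2 * (d + 1) - α * (2 * (d + 1) - 4 * ∑ j, b j) / Q +
        k * (8 * (Q - A) + 2 * (d + 1)) / Q ^ 2 := by
    have e : ∑ j, q j = Q - A := by rw [hQ]; ring
    rw [Finset.sum_add_distrib, Finset.sum_sub_distrib, ← Finset.sum_div, ← Finset.sum_div,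
      ← Finset.mul_sum, ← Finset.mul_sum, Finset.sum_add_distrib, Finset.sum_sub_distrib,
      ← Finset.mul_sum, ← Finset.mul_sum, e]
    simp only [Finset.sum_const, Finset.card_univ, Fintype.card_fin, nsmul_eq_mul]
    push_cast
    ring
  rw [hs]
  have hmain : k * (8 * (Q - A) + 2 * (d + 1)) ≤ 2 * α * (d + 1) * Q := by
    have hd1 : (d : ℝ) + 1 = 2 * (α + 1) := by rw [hα]; ring
    have hk0 : 0 ≤ α * (α + 1) * (α + 2) / 2 + 8 * C := by positivity
    have hkQ : k * Q = α * (α + 1) / 2 * Q + (α * (α + 1) * (α + 2) / 2 + 8 * C) := by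
      rw [hk]; field_simp; ring
    have hk2 : k * (8 * (Q - A) + 2 * (d + 1)) = 8 * (k * Q) - k * (8 * A - 2 * (d + 1)) := by ring
    have hk3 : α * (α + 1) / 2 * (8 * A - 2 * (d + 1)) ≤ k * (8 * A - 2 * (d + 1)) := by
      refine mul_le_mul_of_nonneg_right ?_ (by linarith)
      have : 0 ≤ α * (α + 1) * (α + 2) / 2 / Q := by positivity
      have : 0 ≤ 8 * C / Q := by positivity
      rw [hk]; linarith
    have hk4 : 8 * (α * (α + 1) * (α + 2) / 2 + 8 * C) ≤
        α * (α + 1) / 2 * (8 * A - 2 * (d + 1)) := by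
      have h5 : 3 / 8 ≤ α * (α + 1) / 2 := by
        have := mul_le_mul hα0 (show 3 / 2 ≤ α + 1 by linarith) (by norm_num) (by linarith)
        linarith
      have h6 : 6 * (α * (α + 1) * (α + 2) * 4 + 64 * C) ≤ 8 * A - 2 * (d + 1) := by
        have : 0 ≤ α * (α + 1) * (α + 2) * 4 + 64 * C := by positivity
        linarith
      calc 8 * (α * (α + 1) * (α + 2) / 2 + 8 * C)
          ≤ 3 / 8 * (6 * (α * (α + 1) * (α + 2) * 4 + 64 * C)) := by
            have : 0 ≤ α * (α + 1) * (α + 2) := by positivity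
            linarith
        _ ≤ α * (α + 1) / 2 * (8 * A - 2 * (d + 1)) := by
            refine mul_le_mul h5 h6 (by positivity) (by positivity)
    rw [hk2, hkQ]
    rw [hd1] at hk3 hk4 ⊢
    linarith
  have h7 : k * (8 * (Q - A) + 2 * (d + 1)) / Q ^ 2 ≤ 2 * α * (d + 1) / Q := by
    rw [div_le_div_iff₀ (by positivity) hQ0]
    calc k * (8 * (Q - A) + 2 * (d + 1)) * Q ≤ (2 * α * (d + 1) * Q) * Q := by gcongr
      _ = 2 * α * (d + 1) * Q ^ 2 := by ring
  have h8 : 2 * ((d : ℝ) - 1) = 4 * α := by rw [hα]; ring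
  rw [h8]
  have h9 : α * (2 * (d + 1) - 4 * ∑ j, b j) / Q = 2 * α * (d + 1) / Q - 4 * α * (∑ j, b j) / Q := by
    ring
  rw [h9]
  linarith

theorem sqrt_second_difference {m z : ℝ} (hm : 1 ≤ m) :
    2 * √(m ^ 2 + z ^ 2) + m ^ 2 / (4 * √(m ^ 2 + z ^ 2) ^ 3) ≤
      √(m ^ 2 + (z + 1) ^ 2) + √(m ^ 2 + (z - 1) ^ 2) := by
  set s := √(m ^ 2 + z ^ 2) with hs
  set a := √(m ^ 2 + (z + 1) ^ 2) with ha
  set b := √(m ^ 2 + (z - 1) ^ 2) with hb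
  have hs2 : s ^ 2 = m ^ 2 + z ^ 2 := Real.sq_sqrt (by positivity)
  have ha2 : a ^ 2 = m ^ 2 + (z + 1) ^ 2 := Real.sq_sqrt (by positivity)
  have hb2 : b ^ 2 = m ^ 2 + (z - 1) ^ 2 := Real.sq_sqrt (by positivity)
  have ha0 : 0 ≤ a := Real.sqrt_nonneg _
  have hb0 : 0 ≤ b := Real.sqrt_nonneg _
  have hs1 : 1 ≤ s := by
    rw [hs, Real.one_le_sqrt]
    nlinarith [sq_nonneg z]
  have hab : a * b ≤ s ^ 2 + 1 := by linarith [sq_nonneg (a - b)]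
  have hs1' : 1 ≤ s ^ 2 := one_le_pow₀ hs1
  have hprod : (a * b - (s ^ 2 - 1)) * (a * b + (s ^ 2 - 1)) = 4 * m ^ 2 := by
    have : (a * b) ^ 2 = (m ^ 2 + (z + 1) ^ 2) * (m ^ 2 + (z - 1) ^ 2) := by
      rw [mul_pow, ha2, hb2]
    have h2 : (a * b - (s ^ 2 - 1)) * (a * b + (s ^ 2 - 1)) = (a * b) ^ 2 - (s ^ 2 - 1) ^ 2 := by
      ring
    rw [h2, this, hs2]
    ring
  have hdiff : 0 ≤ a * b - (s ^ 2 - 1) := by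
    by_contra! h
    have h0 : 0 ≤ a * b + (s ^ 2 - 1) := add_nonneg (mul_nonneg ha0 hb0) (by linarith)
    have := mul_nonpos_of_nonpos_of_nonneg h.le h0
    have : 0 < m ^ 2 := by positivity
    linarith
  have h1 : 4 * m ^ 2 ≤ (a * b - (s ^ 2 - 1)) * (2 * s ^ 2) := by
    rw [← hprod]
    exact mul_le_mul_of_nonneg_left (by linarith) hdiff
  have h2 : ((a + b) - 2 * s) * (a + b + 2 * s) = 2 * (a * b - (s ^ 2 - 1)) := by
    linear_combination ha2 + hb2 - 2 * hs2
  have h3 : a + b ≤ 3 * s := by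
    refine abs_le_of_sq_le_sq' ?_ (by positivity) |>.2
    linarith [sq_nonneg (a - b)]
  have h4 : 0 ≤ (a + b) - 2 * s := by
    by_contra! h
    have := mul_neg_of_neg_of_pos h (show 0 < a + b + 2 * s by linarith)
    linarith
  have h5 : 4 * m ^ 2 ≤ ((a + b) - 2 * s) * (5 * s) * s ^ 2 := by
    have : 2 * (a * b - (s ^ 2 - 1)) ≤ ((a + b) - 2 * s) * (5 * s) := by
      rw [← h2]
      exact mul_le_mul_of_nonneg_left (by linarith) h4
    have := mul_le_mul_of_nonneg_right this (sq_nonneg s)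
    linarith
  have h6 : m ^ 2 / (4 * s ^ 3) ≤ (a + b) - 2 * s := by
    rw [div_le_iff₀ (by positivity)]
    have : 0 ≤ ((a + b) - 2 * s) * s ^ 3 := by positivity
    linarith
  linarith

/-! ### Truncated squares -/

/-- The function `a²` on `[-m, m]`, continued with second differences at least `-2` to a function
that is constant outside `[-2m, 2m]`. -/
def cutSq (m a : ℤ) : ℤ :=
  if |a| ≤ m then a ^ 2 else if |a| ≤ 2 * m then 2 * m ^ 2 - (2 * m - |a|) ^ 2 else 2 * m ^ 2

theorem cutSq_neg (m a : ℤ) : cutSq m (-a) = cutSq m a := by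
  simp [cutSq]

theorem cutSq_of_le {m a : ℤ} (h : |a| ≤ m) : cutSq m a = a ^ 2 := if_pos h

theorem cutSq_of_mid {m a : ℤ} (h1 : m ≤ a) (h2 : a ≤ 2 * m) :
    cutSq m a = 2 * m ^ 2 - (2 * m - a) ^ 2 := by
  have h0 : |a| = a := abs_of_nonneg (by omega)
  unfold cutSq
  rw [h0, if_pos h2]
  split_ifs with h
  · rw [le_antisymm h h1]
    ring
  · rfl

theorem cutSq_of_ge {m a : ℤ} (hm : 0 ≤ m) (h : 2 * m ≤ |a|) : cutSq m a = 2 * m ^ 2 := by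
  unfold cutSq
  split_ifs with h1 h2
  · have : m = 0 := by omega
    subst this
    have : a = 0 := abs_nonpos_iff.1 h1
    simp [this]
  · rw [le_antisymm h2 h]
    ring
  · rfl

theorem sq_le_cutSq {m a : ℤ} (h : m ≤ |a|) : m ^ 2 ≤ cutSq m a := by
  unfold cutSq
  split_ifs with h1 h2
  · rw [← sq_abs a, le_antisymm h1 h]
  · have : (2 * m - |a|) ^ 2 ≤ m ^ 2 := pow_le_pow_left₀ (by omega) (by omega) 2
    linarith
  · linarith [sq_nonneg m]

theorem cutSq_nonneg (m a : ℤ) : 0 ≤ cutSq m a := by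
  rcases le_total m |a| with h | h
  · exact (sq_nonneg m).trans (sq_le_cutSq h)
  · rw [cutSq_of_le h]
    exact sq_nonneg a

theorem sq_le_sixteen_mul_cutSq {m a : ℤ} (h : |a| ≤ 4 * m) :
    a ^ 2 ≤ 16 * cutSq m a := by
  rcases le_total m |a| with h1 | h1
  · have := sq_le_cutSq h1
    have h2 : |a| ^ 2 ≤ (4 * m) ^ 2 := pow_le_pow_left₀ (abs_nonneg a) h 2
    rw [sq_abs] at h2
    linarith
  · rw [cutSq_of_le h1]
    linarith [sq_nonneg a]

/-- The increments of `cutSq`: those of the square inside, bounded ones outside. -/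
theorem cutSq_increments {m : ℤ} (hm : 1 ≤ m) (a : ℤ) :
    (|a| < m ∧ cutSq m a = a ^ 2 ∧ cutSq m (a + 1) - cutSq m a = 2 * a + 1 ∧
      cutSq m (a - 1) - cutSq m a = -2 * a + 1) ∨
    (m ≤ |a| ∧ m ^ 2 ≤ cutSq m a ∧ |cutSq m (a + 1) - cutSq m a| ≤ 2 * m ∧
      |cutSq m (a - 1) - cutSq m a| ≤ 2 * m ∧
      -2 ≤ (cutSq m (a + 1) - cutSq m a) + (cutSq m (a - 1) - cutSq m a)) := by
  have key : ∀ a, m ≤ a → |cutSq m (a + 1) - cutSq m a| ≤ 2 * m ∧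
      |cutSq m (a - 1) - cutSq m a| ≤ 2 * m ∧
      -2 ≤ (cutSq m (a + 1) - cutSq m a) + (cutSq m (a - 1) - cutSq m a) := by
    intro a ha
    rcases lt_trichotomy a (2 * m) with h | h | h
    · have e1 : cutSq m (a + 1) - cutSq m a = 2 * (2 * m - a) - 1 := by
        rw [cutSq_of_mid ha h.le, cutSq_of_mid (by omega) (by omega)]
        ring
      rcases ha.eq_or_lt with h0 | h0
      · have e2 : cutSq m (a - 1) - cutSq m a = -2 * a + 1 := by
          rw [cutSq_of_le (a := a - 1) (by rw [abs_le]; omega),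
            cutSq_of_le (a := a) (by rw [abs_le]; omega)]
          ring
        rw [e1, e2, abs_le, abs_le]
        omega
      · have e2 : cutSq m (a - 1) - cutSq m a = -2 * (2 * m - a) - 1 := by
          rw [cutSq_of_mid ha h.le, cutSq_of_mid (by omega) (by omega)]
          ring
        rw [e1, e2, abs_le, abs_le]
        omega
    · have e1 : cutSq m (a + 1) - cutSq m a = 0 := by
        rw [cutSq_of_ge (a := a) (by omega) (le_abs.2 (by omega)),
          cutSq_of_ge (a := a + 1) (by omega) (le_abs.2 (by omega)), sub_self]
      have e2 : cutSq m (a - 1) - cutSq m a = -1 := by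
        rw [cutSq_of_mid (a := a - 1) (by omega) (by omega), cutSq_of_mid ha h.le, h]
        ring
      rw [e1, e2, abs_le, abs_le]
      omega
    · have e1 : cutSq m (a + 1) - cutSq m a = 0 := by
        rw [cutSq_of_ge (a := a) (by omega) (le_abs.2 (by omega)),
          cutSq_of_ge (a := a + 1) (by omega) (le_abs.2 (by omega)), sub_self]
      have e2 : cutSq m (a - 1) - cutSq m a = 0 := by
        rw [cutSq_of_ge (a := a) (by omega) (le_abs.2 (by omega)),
          cutSq_of_ge (a := a - 1) (by omega) (le_abs.2 (by omega)), sub_self]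
      rw [e1, e2, abs_le]
      omega
  rcases lt_or_ge |a| m with h | h
  · refine Or.inl ⟨h, cutSq_of_le h.le, ?_, ?_⟩
    · have := abs_lt.1 h
      rw [cutSq_of_le h.le, cutSq_of_le (a := a + 1) (by rw [abs_le]; omega)]
      ring
    · have := abs_lt.1 h
      rw [cutSq_of_le h.le, cutSq_of_le (a := a - 1) (by rw [abs_le]; omega)]
      ring
  · refine Or.inr ⟨h, sq_le_cutSq h, ?_⟩
    rcases le_abs.1 h with h1 | h1
    · exact key a h1
    · obtain ⟨k1, k2, k3⟩ := key (-a) h1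
      rw [show -a + 1 = -(a - 1) by ring, cutSq_neg, cutSq_neg] at k1 k3
      rw [show -a - 1 = -(a + 1) by ring, cutSq_neg] at k2 k3
      rw [cutSq_neg] at k2
      exact ⟨k2, k1, by omega⟩

theorem cutSq_increment_bounds {m : ℤ} (hm : 1 ≤ m) (a : ℤ) {q u v : ℝ}
    (hq : q = cutSq m a) (hu : u = cutSq m (a + 1) - cutSq m a)
    (hv : v = cutSq m (a - 1) - cutSq m a) :
    2 - 4 * (if m ≤ |a| then (1 : ℝ) else 0) ≤ u + v ∧ u ^ 2 + v ^ 2 ≤ 8 * q + 2 ∧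
      -3 * (8 * q + 2) ≤ u ^ 3 + v ^ 3 := by
  rcases cutSq_increments hm a with ⟨h, h1, h2, h3⟩ | ⟨h, h1, h2, h3, h4⟩
  · have hu' : u = 2 * a + 1 := by rw [hu]; exact_mod_cast h2
    have hv' : v = -2 * a + 1 := by rw [hv]; exact_mod_cast h3
    have hq' : q = (a : ℝ) ^ 2 := by rw [hq]; exact_mod_cast h1
    rw [if_neg (not_le.2 h), hu', hv', hq']
    refine ⟨by linarith, le_of_eq (by ring), ?_⟩
    linarith [sq_nonneg (a : ℝ)]
  · have hu' : |u| ≤ 2 * m := by rw [hu]; exact_mod_cast h2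
    have hv' : |v| ≤ 2 * m := by rw [hv]; exact_mod_cast h3
    have huv : -2 ≤ u + v := by rw [hu, hv]; exact_mod_cast h4
    have hq' : (m : ℝ) ^ 2 ≤ q := by rw [hq]; exact_mod_cast h1
    have hu2 : u ^ 2 ≤ (2 * m) ^ 2 := sq_le_sq' (abs_le.1 hu').1 (abs_le.1 hu').2
    have hv2 : v ^ 2 ≤ (2 * m) ^ 2 := sq_le_sq' (abs_le.1 hv').1 (abs_le.1 hv').2
    rw [if_pos h]
    refine ⟨by linarith, by linarith, ?_⟩
    have h5 : 0 ≤ u ^ 2 - u * v + v ^ 2 := by linarith [sq_nonneg (u - v), sq_nonneg (u + v)]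
    have h6 : u ^ 2 - u * v + v ^ 2 ≤ 12 * q := by linarith [sq_nonneg (u + v)]
    have h7 : -2 * (u ^ 2 - u * v + v ^ 2) ≤ (u + v) * (u ^ 2 - u * v + v ^ 2) :=
      mul_le_mul_of_nonneg_right huv h5
    linarith

theorem cutSq_valMinAbs_cast {N : ℕ} [NeZero N] {m : ℤ} (hm : 0 ≤ m) (hN : 4 * m + 2 ≤ N) {b : ℤ}
    (hb : 2 * |b| ≤ N + 2) : cutSq m (b : ZMod N).valMinAbs = cutSq m b := by
  obtain ⟨hb1, hb2⟩ := abs_le.1 (show |b| ≤ (N + 2 : ℤ) / 2 by omega)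
  rcases lt_or_ge (N : ℤ) (b * 2) with h | h
  · have e : (b : ZMod N).valMinAbs = b - N := by
      refine (ZMod.valMinAbs_spec _ _).2 ⟨by simp, ?_, ?_⟩ <;> omega
    rw [e, cutSq_of_ge hm (le_abs.2 (by omega)), cutSq_of_ge hm (le_abs.2 (by omega))]
  · rcases lt_or_ge (-(N : ℤ)) (b * 2) with h' | h'
    · have e : (b : ZMod N).valMinAbs = b := (ZMod.valMinAbs_spec _ _).2 ⟨rfl, h', h⟩
      rw [e]
    · have e : (b : ZMod N).valMinAbs = b + N := by
        refine (ZMod.valMinAbs_spec _ _).2 ⟨by simp, ?_, ?_⟩ <;> omega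
      rw [e, cutSq_of_ge hm (le_abs.2 (by omega)), cutSq_of_ge hm (le_abs.2 (by omega))]

theorem two_mul_abs_valMinAbs_le {N : ℕ} [NeZero N] (y : ZMod N) : 2 * |y.valMinAbs| ≤ N := by
  have := y.valMinAbs_mem_Ioc
  rcases abs_cases y.valMinAbs with ⟨h, _⟩ | ⟨h, _⟩ <;> rw [h] <;> have h1 := this.1 <;>
    have h2 := this.2 <;> omega

theorem cutSq_valMinAbs_add {N : ℕ} [NeZero N] {m : ℤ} (hm : 0 ≤ m) (hN : 4 * m + 2 ≤ N)
    (y : ZMod N) (e : ℤ) (he : |e| ≤ 1) :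
    cutSq m (y + e).valMinAbs = cutSq m (y.valMinAbs + e) := by
  have h := two_mul_abs_valMinAbs_le y
  have h2 := abs_add_le y.valMinAbs e
  rw [← cutSq_valMinAbs_cast hm hN (b := y.valMinAbs + e) (by omega)]
  congr 2
  push_cast [ZMod.coe_valMinAbs]
  rfl

/-! ### The barrier on the cylinder -/

/-- A regularized squared distance to the origin of the cylinder, equal to `A + |u|²` at the
projection of a lattice point `u` with coordinates at most `m`. -/
noncomputable def cylQuad {d N : ℕ} (A : ℝ) (m : ℕ) (x : Cyl d N) : ℝ :=
  A + (∑ j, (cutSq m (x.1 j).valMinAbs : ℝ) + (x.2 : ℝ) ^ 2)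

/-- A superharmonic function on the cylinder, of order one at the origin. -/
noncomputable def barrier {d N : ℕ} (A : ℝ) (m η : ℕ) (x : Cyl d N) : ℝ :=
  cylQuad A m x ^ (-(((d : ℝ) - 1) / 2)) +
    8 * d * ((d : ℝ) - 1) / (m : ℝ) ^ d *
      (√((m : ℝ) ^ 2 + (2 * (η : ℝ)) ^ 2) - √((m : ℝ) ^ 2 + (x.2 : ℝ) ^ 2))

theorem le_cylQuad {d N : ℕ} (A : ℝ) (m : ℕ) (x : Cyl d N) : A ≤ cylQuad A m x := by
  have : 0 ≤ ∑ j, (cutSq m (x.1 j).valMinAbs : ℝ) :=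
    Finset.sum_nonneg fun j _ => by exact_mod_cast cutSq_nonneg m _
  unfold cylQuad
  linarith [sq_nonneg (x.2 : ℝ)]

theorem cylQuad_add_castSucc {d N m : ℕ} [NeZero N] (hN : 4 * (m : ℤ) + 2 ≤ N) (A : ℝ)
    (y : Torus d N) (z : ℤ) (j : Fin d) (e : ℤ) (he : |e| ≤ 1) :
    cylQuad A m ((y, z) + (Pi.single j (e : ZMod N), 0)) - cylQuad A m (y, z) =
      cutSq m ((y j).valMinAbs + e) - cutSq m (y j).valMinAbs := by
  have h : ∑ i, (cutSq m ((y + (Pi.single j (e : ZMod N) : Torus d N)) i).valMinAbs : ℝ) -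
      ∑ i, (cutSq m (y i).valMinAbs : ℝ) =
      cutSq m ((y j).valMinAbs + e) - cutSq m (y j).valMinAbs := by
    rw [← Finset.sum_sub_distrib, Finset.sum_eq_single j]
    · rw [Pi.add_apply, Pi.single_eq_same, cutSq_valMinAbs_add (Int.natCast_nonneg m) hN _ _ he]
    · intro i _ hi
      rw [Pi.add_apply, Pi.single_eq_of_ne hi, add_zero, sub_self]
    · intro h
      exact absurd (Finset.mem_univ j) h
  unfold cylQuad
  rw [← h]
  simp only [Prod.mk_add_mk, add_zero]
  ring

theorem cylQuad_add_last {d N m : ℕ} (A : ℝ) (y : Torus d N) (z e : ℤ) :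
    cylQuad A m ((y, z) + (0, e)) - cylQuad A m (y, z) = ((z : ℝ) + e) ^ 2 - (z : ℝ) ^ 2 := by
  unfold cylQuad
  simp only [Prod.mk_add_mk, add_zero]
  push_cast
  ring

theorem rpow_neg_le_inv {d : ℕ} (hd : 2 ≤ d) {m s Q : ℝ} (hm : 0 < m) (hs : m ≤ s)
    (hQ : s ^ 2 ≤ Q) : Q ^ (-(((d : ℝ) - 1) / 2)) / Q ≤ m ^ 2 / (m ^ d * s ^ 3) := by
  have hs0 : 0 < s := hm.trans_le hs
  have hQ0 : 0 < Q := lt_of_lt_of_le (by positivity) hQ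
  obtain ⟨k, rfl⟩ := Nat.exists_eq_add_of_le hd
  have h1 : Q ^ (-((((2 + k : ℕ) : ℝ) - 1) / 2)) / Q = Q ^ (-(((k : ℝ) + 3) / 2)) := by
    rw [← Real.rpow_sub_one hQ0.ne']
    congr 1
    push_cast
    ring
  have h2 : Q ^ (-(((k : ℝ) + 3) / 2)) ≤ (s ^ 2) ^ (-(((k : ℝ) + 3) / 2)) :=
    Real.rpow_le_rpow_of_nonpos (by positivity) hQ (by
      have : (0 : ℝ) ≤ k := Nat.cast_nonneg k
      linarith)
  have h3 : (s ^ 2) ^ (-(((k : ℝ) + 3) / 2)) = (s ^ (k + 3))⁻¹ := by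
    rw [← Real.rpow_natCast s 2, ← Real.rpow_mul hs0.le, ← Real.rpow_natCast s (k + 3),
      ← Real.rpow_neg hs0.le]
    congr 1
    push_cast
    ring
  rw [h1]
  refine h2.trans ?_
  rw [h3]
  have h4 : m ^ 2 / (m ^ (2 + k) * s ^ 3) = (m ^ k * s ^ 3)⁻¹ := by
    rw [pow_add]
    field_simp
  rw [h4]
  gcongr
  rw [pow_add]
  gcongr

theorem barrier_superharmonic {d : ℕ} (hd : 2 ≤ d) : ∃ A : ℝ, 1 ≤ A ∧
    ∀ (N m η : ℕ) [NeZero N], 1 ≤ m → 4 * m + 2 ≤ N → ∀ x : Cyl d N,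
      stepAvg (cylStep d N) (barrier A m η) x ≤ barrier A m η x := by
  obtain ⟨A, hA, hkey⟩ := exists_superharmonic_const d hd
  have hd' : (2 : ℝ) ≤ d := by exact_mod_cast hd
  refine ⟨A, hA, ?_⟩
  rintro N m η _ hm hN ⟨y, z⟩
  have hNz : 4 * (m : ℤ) + 2 ≤ N := by exact_mod_cast hN
  have hmz : (1 : ℤ) ≤ m := by exact_mod_cast hm
  have hm' : (1 : ℝ) ≤ m := by exact_mod_cast hm
  set q : Fin (d + 1) → ℝ :=
    Fin.snoc (α := fun _ => ℝ) (fun j => (cutSq m (y j).valMinAbs : ℝ)) ((z : ℝ) ^ 2) with hq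
  set b : Fin (d + 1) → ℝ := Fin.snoc (α := fun _ => ℝ)
    (fun j => if (m : ℤ) ≤ |(y j).valMinAbs| then (1 : ℝ) else 0) 0 with hb
  set Δ : Fin (d + 1) × Bool → ℝ := fun p =>
    cylQuad A m ((y, z) + cylStep d N p) - cylQuad A m (y, z) with hΔ
  have hqc : ∀ j, q (Fin.castSucc j) = (cutSq m (y j).valMinAbs : ℝ) := fun j => by simp [hq]
  have hql : q (Fin.last d) = (z : ℝ) ^ 2 := by simp [hq]
  have hbc : ∀ j, b (Fin.castSucc j) = if (m : ℤ) ≤ |(y j).valMinAbs| then (1 : ℝ) else 0 :=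
    fun j => by simp [hb]
  have hbl : b (Fin.last d) = 0 := by simp [hb]
  have hΔc : ∀ j, Δ (Fin.castSucc j, true) =
        cutSq m ((y j).valMinAbs + 1) - cutSq m (y j).valMinAbs ∧
      Δ (Fin.castSucc j, false) =
        cutSq m ((y j).valMinAbs - 1) - cutSq m (y j).valMinAbs := by
    intro j
    have h1 := cylQuad_add_castSucc hNz A y z j 1 (by simp)
    have h2 := cylQuad_add_castSucc hNz A y z j (-1) (by simp)
    simp only [hΔ, cylStep_castSucc]
    push_cast at h1 h2
    exact ⟨by simpa using h1, by simpa [sub_eq_add_neg] using h2⟩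
  have hΔl : Δ (Fin.last d, true) = 2 * z + 1 ∧ Δ (Fin.last d, false) = -2 * z + 1 := by
    simp only [hΔ, cylStep_last, cylQuad_add_last]
    constructor
    · push_cast
      ring
    · simp only [Bool.false_eq_true, if_false]
      push_cast
      ring
  have hQ : cylQuad A m (y, z) = A + ∑ j, q j := by
    rw [Fin.sum_univ_castSucc]
    simp only [hqc, hql]
    rfl
  have hq0 : ∀ j, 0 ≤ q j := by
    intro j
    induction j using Fin.lastCases with
    | last => rw [hql]; positivity
    | cast j =>
      rw [hqc]
      exact_mod_cast cutSq_nonneg m _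
  have hbounds : ∀ j, 2 - 4 * b j ≤ Δ (j, true) + Δ (j, false) ∧
      Δ (j, true) ^ 2 + Δ (j, false) ^ 2 ≤ 8 * q j + 2 ∧
      -3 * (8 * q j + 2) ≤ Δ (j, true) ^ 3 + Δ (j, false) ^ 3 := by
    intro j
    induction j using Fin.lastCases with
    | last =>
      rw [hql, hbl, hΔl.1, hΔl.2]
      exact ⟨by linarith, le_of_eq (by ring), by linarith [sq_nonneg (z : ℝ)]⟩
    | cast j =>
      rw [hbc]
      exact cutSq_increment_bounds hmz _ (hqc j) (hΔc j).1 (hΔc j).2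
  have h1 := hkey q b Δ hq0 (fun j => (hbounds j).1) (fun j => (hbounds j).2.1)
    (fun j => (hbounds j).2.2)
  rw [← hQ] at h1
  simp only [hΔ, add_sub_cancel] at h1
  set Q := cylQuad A m (y, z) with hQdef
  set s := √((m : ℝ) ^ 2 + (z : ℝ) ^ 2) with hs
  have hs2 : s ^ 2 = (m : ℝ) ^ 2 + (z : ℝ) ^ 2 := Real.sq_sqrt (by positivity)
  have hms : (m : ℝ) ≤ s := Real.le_sqrt_of_sq_le (by linarith [sq_nonneg (z : ℝ)])
  have hQ0 : 0 < Q := lt_of_lt_of_le (by linarith) (le_cylQuad A m (y, z))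
  have herr : Q ^ (-(((d : ℝ) - 1) / 2)) * (2 * ((d : ℝ) - 1) * (∑ j, b j) / Q) ≤
      2 * d * ((d : ℝ) - 1) * ((m : ℝ) ^ 2 / ((m : ℝ) ^ d * s ^ 3)) := by
    have hbd : ∑ j, b j ≤ d := by
      rw [Fin.sum_univ_castSucc, hbl, add_zero]
      calc ∑ j : Fin d, b j.castSucc ≤ ∑ j : Fin d, (1 : ℝ) := by
            refine Finset.sum_le_sum fun j _ => ?_
            rw [hbc]
            split_ifs <;> norm_num
        _ = d := by simp
    by_cases hex : ∃ j, (m : ℤ) ≤ |(y j).valMinAbs|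
    · obtain ⟨j, hj⟩ := hex
      have hsQ : s ^ 2 ≤ Q := by
        have h2 : (m : ℝ) ^ 2 ≤ q j.castSucc := by
          rw [hqc]
          exact_mod_cast sq_le_cutSq hj
        have h3 : q j.castSucc ≤ ∑ i : Fin d, q i.castSucc :=
          Finset.single_le_sum (f := fun i : Fin d => q i.castSucc)
            (fun i _ => hq0 _) (Finset.mem_univ j)
        rw [hQ, Fin.sum_univ_castSucc, hql, hs2]
        linarith
      have h4 := rpow_neg_le_inv hd (by linarith) hms hsQ
      have h5 : 0 ≤ Q ^ (-(((d : ℝ) - 1) / 2)) / Q := div_nonneg (Real.rpow_nonneg hQ0.le _) hQ0.le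
      calc Q ^ (-(((d : ℝ) - 1) / 2)) * (2 * ((d : ℝ) - 1) * (∑ j, b j) / Q)
          = 2 * ((d : ℝ) - 1) * (∑ j, b j) * (Q ^ (-(((d : ℝ) - 1) / 2)) / Q) := by ring
        _ ≤ 2 * ((d : ℝ) - 1) * d * (Q ^ (-(((d : ℝ) - 1) / 2)) / Q) := by
            refine mul_le_mul_of_nonneg_right ?_ h5
            exact mul_le_mul_of_nonneg_left hbd (by linarith)
        _ ≤ 2 * ((d : ℝ) - 1) * d * ((m : ℝ) ^ 2 / ((m : ℝ) ^ d * s ^ 3)) :=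
            mul_le_mul_of_nonneg_left h4 (mul_nonneg (by linarith) (by linarith))
        _ = _ := by ring
    · push Not at hex
      have h0 : ∑ j, b j = 0 := by
        rw [Fin.sum_univ_castSucc, hbl, add_zero]
        refine Finset.sum_eq_zero fun j _ => ?_
        rw [hbc, if_neg (not_le.2 (hex j))]
      rw [h0]
      have : 0 ≤ (d : ℝ) - 1 := by linarith
      simp only [mul_zero, zero_div]
      positivity
  have hsd := sqrt_second_difference (m := (m : ℝ)) (z := (z : ℝ)) hm'
  rw [← hs] at hsd
  have hsum : ∑ p, √((m : ℝ) ^ 2 + ((((y, z) + cylStep d N p).2 : ℤ) : ℝ) ^ 2) =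
      2 * d * s + (√((m : ℝ) ^ 2 + ((z : ℝ) + 1) ^ 2) + √((m : ℝ) ^ 2 + ((z : ℝ) - 1) ^ 2)) := by
    rw [sum_cylStep (fun x : Cyl d N => √((m : ℝ) ^ 2 + (x.2 : ℝ) ^ 2))]
    simp only [Finset.sum_const, Finset.card_univ, Fintype.card_fin, nsmul_eq_mul, ← hs]
    push_cast
    ring
  set κ : ℝ := 8 * d * ((d : ℝ) - 1) / (m : ℝ) ^ d with hκ
  have hκ0 : 0 ≤ κ := div_nonneg (mul_nonneg (by positivity) (by linarith)) (by positivity)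
  have h6 : 2 * d * ((d : ℝ) - 1) * ((m : ℝ) ^ 2 / ((m : ℝ) ^ d * s ^ 3)) =
      κ * ((m : ℝ) ^ 2 / (4 * s ^ 3)) := by
    rw [hκ]
    have : s ≠ 0 := by linarith
    have : (m : ℝ) ≠ 0 := by linarith
    field_simp
    ring
  have h7 := mul_le_mul_of_nonneg_left hsd hκ0
  rw [stepAvg, div_le_iff₀ (by positivity)]
  simp only [barrier, Finset.sum_add_distrib, ← Finset.mul_sum, Finset.sum_sub_distrib, hsum,
    ← hQdef, ← hκ, ← hs]
  simp only [Finset.sum_const, Finset.card_univ, Fintype.card_prod, Fintype.card_fin,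
    Fintype.card_bool, nsmul_eq_mul]
  push_cast
  rw [h6] at herr
  rw [mul_add (Q ^ (-(((d : ℝ) - 1) / 2)))] at h1
  linarith

/-! ### Hitting probabilities on the lattice -/

theorem hitProb_univ_le_of_superharmonic {d : ℕ} {G : Type*} [AddCommGroup G] [MeasurableSpace G]
    [Countable G] [MeasurableSingletonClass G] (s : Fin (d + 1) × Bool → G) (K : Set G)
    (V : G → ℝ) (h0 : ∀ u, 0 ≤ V u) (h1 : ∀ u ∈ K, 1 ≤ V u)
    (hV : ∀ u, u ∉ K → stepAvg s V u ≤ V u) (u : G) : hitProb s K Set.univ u ≤ V u := by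
  set E : ℕ → Set (ℕ → G) := fun n => {w | ∃ m, m ≤ n ∧ w m ∈ K} with hE
  have hmeas : ∀ n, MeasurableSet (E n) := fun n => by
    simp only [hE, Set.ofPred_exists, Set.ofPred_and]
    exact MeasurableSet.iUnion fun m => (MeasurableSet.const _).inter (measurableSet_coord_mem m K)
  have hmono : Monotone E := fun a b hab w ⟨m, hm, hw⟩ => ⟨m, hm.trans hab, hw⟩
  have hU : ⋃ n, E n = hitBefore K Set.univ := by
    ext w
    simp only [hE, hitBefore, Set.mem_iUnion, Set.mem_ofPred_eq, Set.mem_univ, implies_true,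
      and_true]
    exact ⟨fun ⟨_, m, _, hm⟩ => ⟨m, hm⟩, fun ⟨m, hm⟩ => ⟨m, m, le_rfl, hm⟩⟩
  have hle : ∀ n u, (walkLaw s u).real (E n) ≤ V u := by
    intro n
    induction n with
    | zero =>
      intro u
      by_cases hu : u ∈ K
      · exact measureReal_le_one.trans (h1 u hu)
      · rw [walkLaw_real_eq_zero s u (hmeas 0)]
        · exact h0 u
        · rintro w hw ⟨m, hm, hwm⟩
          rw [Nat.le_zero.1 hm, hw] at hwm
          exact hu hwm
    | succ n ih =>
      intro u
      by_cases hu : u ∈ K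
      · exact measureReal_le_one.trans (h1 u hu)
      · rw [walkLaw_real_eq_stepAvg s u (hmeas (n + 1)) (hmeas n)]
        · exact (stepAvg_mono s fun p => ih _).trans (hV u hu)
        · intro w hw
          constructor
          · rintro ⟨m, hm, hwm⟩
            cases m with
            | zero => rw [hw] at hwm; exact absurd hwm hu
            | succ m => exact ⟨m, by omega, hwm⟩
          · rintro ⟨m, hm, hwm⟩
            exact ⟨m + 1, by omega, hwm⟩
  have hlim := tendsto_measure_iUnion_atTop (μ := walkLaw s u) hmono
  rw [hU] at hlim
  have hlim' := (ENNReal.tendsto_toReal (measure_ne_top _ _)).comp hlim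
  exact le_of_tendsto' hlim' fun n => hle n u

theorem tendsto_sq_dist_cofinite (d : ℕ) (A : ℝ) (k : ZLat d) :
    Tendsto (fun u : ZLat d => A + ∑ j, (((u - k) j : ℤ) : ℝ) ^ 2) cofinite atTop := by
  refine tendsto_atTop.2 fun R => ?_
  obtain ⟨n, hn⟩ := exists_nat_gt (R - A)
  have hfin : (Set.Icc (k - fun _ => (n : ℤ)) (k + fun _ => (n : ℤ))).Finite := Set.finite_Icc _ _
  refine (Set.Finite.subset hfin fun u hu => ?_ : Set.Finite _)
  have hu' : ∑ j, (((u - k) j : ℤ) : ℝ) ^ 2 < n := by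
    have : ¬ R ≤ A + ∑ j, (((u - k) j : ℤ) : ℝ) ^ 2 := hu
    linarith [not_le.1 this]
  have hj : ∀ j, |(u - k) j| ≤ n := by
    intro j
    have h1 := Finset.single_le_sum (f := fun j => (((u - k) j : ℤ) : ℝ) ^ 2)
      (fun i _ => sq_nonneg _) (Finset.mem_univ j)
    have h2 : ((u - k) j) ^ 2 < n := by exact_mod_cast h1.trans_lt hu'
    by_contra! h3
    have h4 : |(u - k) j| ≤ |(u - k) j| ^ 2 := by
      have : 0 ≤ |(u - k) j| := abs_nonneg _
      nlinarith
    rw [sq_abs] at h4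
    omega
  constructor
  · intro j
    have := (abs_le.1 (hj j)).1
    simp only [Pi.sub_apply] at this ⊢
    omega
  · intro j
    have := (abs_le.1 (hj j)).2
    simp only [Pi.sub_apply, Pi.add_apply] at this ⊢
    omega

/-- A function that is harmonic off `K`, equal to one on `K`, and that tends to zero at infinity
at the rate of the Green function, is the hitting probability of `K`. -/
theorem eq_hitProb_univ {d : ℕ} (hd : 2 ≤ d) (K : Finset (ZLat d)) (V : ZLat d → ℝ)
    (A a : ℝ) (h0 : ∀ u, 0 ≤ V u) (h1 : ∀ u ∈ K, V u = 1)
    (hV : ∀ u, u ∉ K → V u = stepAvg (unitStep d) V u)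
    (hdecay : ∀ u, V u ≤
      ∑ k ∈ K, a * (A + ∑ j, (((u - k) j : ℤ) : ℝ) ^ 2) ^ (-(((d : ℝ) - 1) / 2)))
    (u : ZLat d) : V u = hitProb (unitStep d) (K : Set (ZLat d)) Set.univ u := by
  refine le_antisymm ?_ (hitProb_univ_le_of_superharmonic _ _ V h0 (fun u hu => (h1 u hu).ge)
    (fun u hu => (hV u hu).ge) u)
  rw [← sub_nonpos]
  have hα : 0 < ((d : ℝ) - 1) / 2 := by
    have : (2 : ℝ) ≤ d := by exact_mod_cast hd
    linarith
  have hlim : Tendsto (fun u => ∑ k ∈ K,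
      a * (A + ∑ j, (((u - k) j : ℤ) : ℝ) ^ 2) ^ (-(((d : ℝ) - 1) / 2))) cofinite (𝓝 0) := by
    have : (0 : ℝ) = ∑ k ∈ K, a * 0 := by simp
    rw [this]
    exact tendsto_finsetSum _ fun k _ =>
      ((tendsto_rpow_neg_atTop hα).comp (tendsto_sq_dist_cofinite d A k)).const_mul a
  refine nonpos_of_subharmonic (unitStep d) (Fin.last d, true) ?_
    (fun u => V u - hitProb (unitStep d) (K : Set (ZLat d)) Set.univ u) ?_ ?_ u
  · intro m n h
    have := congrFun h (Fin.last d)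
    simpa [unitStep] using this
  · intro ε hε
    have := hlim.eventually (gt_mem_nhds hε)
    refine Set.Finite.subset this fun u hu => ?_
    have hu' : ε ≤ V u - hitProb (unitStep d) (K : Set (ZLat d)) Set.univ u := hu
    have h3 := hitProb_nonneg (unitStep d) (K : Set (ZLat d)) Set.univ u
    intro hlt
    have hlt' : ∑ k ∈ K, a * (A + ∑ j, (((u - k) j : ℤ) : ℝ) ^ 2) ^ (-(((d : ℝ) - 1) / 2)) < ε :=
      hlt
    linarith [hdecay u]
  · intro u hu
    have huK : u ∉ K := by
      intro h
      rw [h1 u h, hitProb_of_mem _ (Set.mem_univ u) (Finset.mem_coe.2 h), sub_self] at hu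
      exact lt_irrefl _ hu
    refine stepAvg_subharmonic _ (fun u => V u - hitProb (unitStep d) (K : Set (ZLat d)) Set.univ u)
      u ?_
    rw [stepAvg_sub, ← hV u huK,
      ← hitProb_eq_stepAvg _ (Set.mem_univ u) (by exact_mod_cast huK)]

theorem latticeLaw_real_no_return {d : ℕ} (K : Finset (ZLat d)) (x : ZLat d) :
    (latticeLaw d x).real {w | hitTime (K : Set (ZLat d)) w = ⊤} =
      1 - stepAvg (unitStep d) (hitProb (unitStep d) (K : Set (ZLat d)) Set.univ) x := by
  have hm := measurableSet_hitBefore (K : Set (ZLat d)) Set.univ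
  have hmeas : MeasurableSet {w : ℕ → ZLat d | hitTime (K : Set (ZLat d)) w = ⊤} := by
    unfold hitTime
    simp only [hittingAfter_eq_top_iff, Set.ofPred_forall]
    exact MeasurableSet.iInter fun m => MeasurableSet.iInter fun _ =>
      measurableSet_coord_mem m (K : Set (ZLat d))ᶜ
  rw [latticeLaw, walkLaw_real_eq_stepAvg _ x hmeas hm.compl
    (fun w _ => hitTime_eq_top_iff (K : Set (ZLat d)) w)]
  have h := stepAvg_congr (unitStep d) (x := x)
    (f := fun y => (walkLaw (unitStep d) y).real (hitBefore (K : Set (ZLat d)) Set.univ)ᶜ)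
    (g := fun y => 1 - hitProb (unitStep d) (K : Set (ZLat d)) Set.univ y)
    fun p => probReal_compl_eq_one_sub hm
  rw [h, stepAvg_sub, stepAvg_const]

/-! ### Bounds on the barrier -/

section barrier

variable {d N : ℕ}

theorem barrier_nonneg (hd : 1 ≤ d) {A : ℝ} (hA : 0 ≤ A) {m η : ℕ} {x : Cyl d N}
    (hx : |x.2| ≤ 2 * η) : 0 ≤ barrier A m η x := by
  have hd' : (1 : ℝ) ≤ d := by exact_mod_cast hd
  have h1 : √((m : ℝ) ^ 2 + (x.2 : ℝ) ^ 2) ≤ √((m : ℝ) ^ 2 + (2 * (η : ℝ)) ^ 2) := by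
    refine Real.sqrt_le_sqrt ?_
    have : |(x.2 : ℝ)| ≤ 2 * η := by exact_mod_cast hx
    linarith [sq_le_sq' (abs_le.1 this).1 (abs_le.1 this).2]
  refine add_nonneg (Real.rpow_nonneg (hA.trans (le_cylQuad A m x)) _) (mul_nonneg ?_ ?_)
  · exact div_nonneg (mul_nonneg (by positivity) (by linarith)) (by positivity)
  · linarith

theorem le_barrier_zero (hd : 1 ≤ d) (A : ℝ) (m η : ℕ) :
    A ^ (-(((d : ℝ) - 1) / 2)) ≤ barrier A m η (0 : Cyl d N) := by
  have hd' : (1 : ℝ) ≤ d := by exact_mod_cast hd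
  have h0 : cylQuad A m (0 : Cyl d N) = A := by
    simp [cylQuad, cutSq]
  have h1 : √((m : ℝ) ^ 2 + (((0 : Cyl d N).2 : ℤ) : ℝ) ^ 2) ≤
      √((m : ℝ) ^ 2 + (2 * (η : ℝ)) ^ 2) := by
    refine Real.sqrt_le_sqrt ?_
    simp
  unfold barrier
  rw [h0]
  refine le_add_of_nonneg_right (mul_nonneg ?_ ?_)
  · exact div_nonneg (mul_nonneg (by positivity) (by linarith)) (by positivity)
  · linarith

theorem barrier_le (hd : 1 ≤ d) (A : ℝ) (m η : ℕ) (x : Cyl d N) :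
    barrier A m η x ≤ cylQuad A m x ^ (-(((d : ℝ) - 1) / 2)) +
      16 * d * ((d : ℝ) - 1) * ((η : ℝ) / (m : ℝ) ^ d) := by
  have hd' : (1 : ℝ) ≤ d := by exact_mod_cast hd
  have h1 : √((m : ℝ) ^ 2 + (2 * (η : ℝ)) ^ 2) ≤ m + 2 * η := by
    refine Real.sqrt_le_iff.2 ⟨by positivity, ?_⟩
    have : (0 : ℝ) ≤ m * η := by positivity
    linarith
  have h2 : (m : ℝ) ≤ √((m : ℝ) ^ 2 + (x.2 : ℝ) ^ 2) :=
    Real.le_sqrt_of_sq_le (by linarith [sq_nonneg (x.2 : ℝ)])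
  unfold barrier
  have h3 : 16 * d * ((d : ℝ) - 1) * ((η : ℝ) / (m : ℝ) ^ d) =
      8 * d * ((d : ℝ) - 1) / (m : ℝ) ^ d * (2 * η) := by ring
  rw [h3]
  have h4 : 0 ≤ 8 * d * ((d : ℝ) - 1) / (m : ℝ) ^ d :=
    div_nonneg (mul_nonneg (by positivity) (by linarith)) (by positivity)
  linarith [mul_le_mul_of_nonneg_left (show √((m : ℝ) ^ 2 + (2 * (η : ℝ)) ^ 2) -
    √((m : ℝ) ^ 2 + (x.2 : ℝ) ^ 2) ≤ 2 * η by linarith) h4]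

theorem stepAvg_translate {G : Type*} [AddCommGroup G] (s : Fin (d + 1) × Bool → G) (f : G → ℝ)
    (c x : G) : stepAvg s (fun y => f (y - c)) x = stepAvg s f (x - c) := by
  simp only [stepAvg, add_sub_right_comm]

/-- A superharmonic function that is at least one on `C` dominates the hitting probability. -/
theorem hitProb_le_of_superharmonic [NeZero N] {η : ℕ} {ζ : ℤ} {C : Set (Cyl d N)}
    (S : Cyl d N → ℝ) (hS : ∀ x, stepAvg (cylStep d N) S x ≤ S x) (h1 : ∀ x ∈ C, 1 ≤ S x)
    (h0 : ∀ x, |x.2 - ζ| ≤ η → 0 ≤ S x) {x : Cyl d N}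
    (hx : x ∈ block d N (bigInterval η ζ)) :
    hitProb (cylStep d N) C (block d N (bigInterval η ζ)) x ≤ S x := by
  have hin : ∀ y ∈ block d N (bigInterval η ζ), 0 ≤ S y := by
    rintro y ⟨h2, h3⟩
    exact h0 y (by rw [abs_le]; constructor <;> omega)
  have key := nonpos_of_subharmonic_on_slab η ζ
    (fun y => hitProb (cylStep d N) C (block d N (bigInterval η ζ)) y - max (S y) 0) ?_ ?_ x
  · rw [max_eq_left (hin x hx)] at key
    linarith
  · intro y hy
    rw [hitProb_of_notMem _ hy]
    linarith [le_max_right (S y) 0]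
  · intro y hy hpos
    have hyC : y ∉ C := by
      intro h
      rw [hitProb_of_mem _ hy h] at hpos
      linarith [le_max_left (S y) 0, h1 y h]
    have hmax : stepAvg (cylStep d N) (fun y => max (S y) 0) y = stepAvg (cylStep d N) S y := by
      refine stepAvg_congr _ fun p => max_eq_left ?_
      rcases mem_slab_add_cylStep hy p with h | h | h
      · exact hin _ h
      · exact h0 _ (by rw [h, abs_le]; constructor <;> omega)
      · exact h0 _ (by rw [h, abs_le]; constructor <;> omega)
    rw [stepAvg_sub, hmax, ← hitProb_eq_stepAvg _ hy hyC]
    linarith [hS y, le_max_left (S y) 0]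

end barrier

/-! ### The projection and the distance -/

section proj

variable {d N : ℕ}

theorem proj_add (u w : ZLat d) : proj d N (u + w) = proj d N u + proj d N w := by
  refine Prod.ext (funext fun j => ?_) ?_ <;> simp [proj]

theorem proj_sub (u w : ZLat d) : proj d N (u - w) = proj d N u - proj d N w := by
  refine Prod.ext (funext fun j => ?_) ?_ <;> simp [proj]

theorem cylDist_le {x y : Cyl d N} {u : ZLat d} (h : proj d N u = x - y) :
    cylDist x y ≤ √(∑ j, (u j : ℝ) ^ 2) :=
  csInf_le ⟨0, by rintro r ⟨u, _, rfl⟩; exact Real.sqrt_nonneg _⟩ ⟨u, h, rfl⟩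

theorem cylDist_nonneg (x y : Cyl d N) : 0 ≤ cylDist x y :=
  Real.sInf_nonneg (by rintro r ⟨u, _, rfl⟩; exact Real.sqrt_nonneg _)

theorem eq_of_proj_eq {u w : ZLat d} (h : proj d N u = proj d N w)
    (hlt : ∀ j, |u j - w j| < N) : u = w := by
  funext j
  induction j using Fin.lastCases with
  | last => exact congrArg Prod.snd h
  | cast j =>
    have h1 : ((u j.castSucc : ℤ) : ZMod N) = (w j.castSucc : ℤ) := congrFun (congrArg Prod.fst h) j
    have h2 := (ZMod.intCast_eq_intCast_iff_dvd_sub _ _ _).1 h1.symm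
    have h3 := Int.eq_zero_of_abs_lt_dvd h2 (hlt _)
    omega

theorem cylQuad_proj [NeZero N] {m : ℕ} (hN : 4 * (m : ℤ) + 2 ≤ N) (A : ℝ) {u : ZLat d}
    (hu : ∀ j, |u j| ≤ m) : cylQuad A m (proj d N u) = A + ∑ j, (u j : ℝ) ^ 2 := by
  rw [Fin.sum_univ_castSucc]
  unfold cylQuad proj
  congr 2
  refine Finset.sum_congr rfl fun j _ => ?_
  have := hu j.castSucc
  simp only
  rw [cutSq_valMinAbs_cast (Int.natCast_nonneg m) hN (by omega), cutSq_of_le this]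
  push_cast
  rfl

theorem cylDist_sq_le [NeZero N] {m : ℕ} (hN : (N : ℤ) ≤ 8 * m) {A : ℝ} (hA : 0 ≤ A)
    (x y : Cyl d N) (w : ZLat d) :
    cylDist x y ^ 2 ≤ 32 * cylQuad A m (x - y + proj d N w) + 2 * ∑ j, (w j : ℝ) ^ 2 := by
  set X := x - y + proj d N w with hX
  set ℓ : ZLat d := Fin.snoc (α := fun _ => ℤ) (fun j => (X.1 j).valMinAbs) X.2 with hℓ
  have hlift : proj d N ℓ = X := by
    refine Prod.ext (funext fun j => ?_) ?_ <;> simp [proj, hℓ]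
  have hu : proj d N (ℓ - w) = x - y := by
    rw [proj_sub, hlift, hX, add_sub_cancel_right]
  have h1 : cylDist x y ^ 2 ≤ ∑ j, (((ℓ - w) j : ℤ) : ℝ) ^ 2 := by
    have := pow_le_pow_left₀ (cylDist_nonneg x y) (cylDist_le hu) 2
    rwa [Real.sq_sqrt (Finset.sum_nonneg fun j _ => sq_nonneg _)] at this
  have h2 : ∑ j, (((ℓ - w) j : ℤ) : ℝ) ^ 2 ≤ 2 * ∑ j, (ℓ j : ℝ) ^ 2 + 2 * ∑ j, (w j : ℝ) ^ 2 := by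
    rw [Finset.mul_sum, Finset.mul_sum, ← Finset.sum_add_distrib]
    refine Finset.sum_le_sum fun j _ => ?_
    rw [Pi.sub_apply, Int.cast_sub]
    linarith [sq_nonneg ((ℓ j : ℝ) + w j)]
  have h3 : ∑ j, (ℓ j : ℝ) ^ 2 ≤ 16 * cylQuad A m X := by
    rw [Fin.sum_univ_castSucc]
    simp only [hℓ, Fin.snoc_castSucc, Fin.snoc_last]
    have h4 : ∑ j, ((X.1 j).valMinAbs : ℝ) ^ 2 ≤
        16 * ∑ j, (cutSq m (X.1 j).valMinAbs : ℝ) := by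
      rw [Finset.mul_sum]
      refine Finset.sum_le_sum fun j _ => ?_
      have := two_mul_abs_valMinAbs_le (X.1 j)
      exact_mod_cast sq_le_sixteen_mul_cutSq (m := m) (a := (X.1 j).valMinAbs) (by omega)
    unfold cylQuad
    linarith [sq_nonneg (X.2 : ℝ)]
  linarith

end proj

/-! ### Convergence of the capacities -/

section capacity

variable {d M : ℕ} {K : Fin M → Finset (ZLat d)} {x : (N : ℕ) → Fin M → Cyl d N}
  {I : Finset (Fin M)} {ζ : ℕ → ℤ} {h : ℕ → ℕ} {C : (N : ℕ) → Finset (Cyl d N)}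

theorem eventually_translate_ne
    (hx : ∀ i j, i ≠ j → Tendsto (fun N => cylDist (x N i) (x N j)) atTop atTop)
    {i j : Fin M} {u k : ZLat d} (hne : i = j → u ≠ k) :
    ∀ᶠ N in atTop, x N i + proj d N u ≠ x N j + proj d N k := by
  by_cases hij : i = j
  · subst hij
    obtain ⟨n, hn⟩ : ∃ n : ℕ, ∀ j, |u j - k j| < n := by
      refine ⟨(∑ j, |u j - k j|).toNat + 1, fun j => ?_⟩
      have := Finset.single_le_sum (f := fun j => |u j - k j|) (fun i _ => abs_nonneg _)
        (Finset.mem_univ j)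
      push_cast
      omega
    filter_upwards [eventually_ge_atTop n] with N hN heq
    refine hne rfl (eq_of_proj_eq (add_left_cancel heq) fun j => (hn j).trans_le ?_)
    exact_mod_cast hN
  · filter_upwards [(hx i j hij).eventually_gt_atTop (√(∑ l, (((k - u) l : ℤ) : ℝ) ^ 2))]
      with N hN heq
    refine absurd (cylDist_le (u := k - u) ?_) (not_le.2 hN)
    rw [proj_sub, sub_eq_sub_iff_add_eq_add, add_comm, ← heq, add_comm]

theorem eventually_mem_slab
    (hheight : ∀ i ∈ I, ∀ c : ℕ, ∀ᶠ N in atTop, |(x N i).2 - ζ N| + c < h N)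
    {i : Fin M} (hi : i ∈ I) (u : ZLat d) :
    ∀ᶠ N in atTop, x N i + proj d N u ∈ block d N (bigInterval (h N) (ζ N)) := by
  filter_upwards [hheight i hi (u (Fin.last d)).natAbs] with N hN
  have h1 : (x N i + proj d N u).2 = (x N i).2 + u (Fin.last d) := rfl
  change ζ N - h N < (x N i + proj d N u).2 ∧ (x N i + proj d N u).2 < ζ N + h N
  rw [h1]
  have := abs_le.1 (le_refl |(x N i).2 - ζ N|)
  omega

theorem tendsto_height_ratio (hh : Tendsto (fun N => (h N : ℝ) / (N : ℝ) ^ d) atTop (𝓝 0)) :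
    Tendsto (fun N => (h N : ℝ) / ((((N - 2) / 4 : ℕ) : ℝ)) ^ d) atTop (𝓝 0) := by
  have h2 := hh.const_mul ((8 : ℝ) ^ d)
  rw [mul_zero] at h2
  refine squeeze_zero' (Eventually.of_forall fun N => by positivity) ?_ h2
  filter_upwards [eventually_ge_atTop 10] with N hN
  have h3 : (N : ℝ) ≤ 8 * (((N - 2) / 4 : ℕ) : ℝ) := by
    have : N ≤ 8 * ((N - 2) / 4) := by omega
    exact_mod_cast this
  have h4 : (0 : ℝ) < N := by exact_mod_cast (by omega : 0 < N)
  have h5 : (0 : ℝ) < (((N - 2) / 4 : ℕ) : ℝ) := by linarith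
  rw [← mul_div_assoc, div_le_div_iff₀ (by positivity) (by positivity)]
  have := pow_le_pow_left₀ h4.le h3 d
  rw [mul_pow] at this
  have h6 : (0 : ℝ) ≤ h N := Nat.cast_nonneg _
  calc (h N : ℝ) * (N : ℝ) ^ d ≤ h N * (8 ^ d * (((N - 2) / 4 : ℕ) : ℝ) ^ d) := by gcongr
    _ = _ := by ring

theorem tendsto_cylQuad_rpow (hd : 2 ≤ d)
    (hx : ∀ i j, i ≠ j → Tendsto (fun N => cylDist (x N i) (x N j)) atTop atTop)
    {A : ℝ} (hA : 1 ≤ A) (i j : Fin M) (w : ZLat d) :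
    Tendsto (fun N => cylQuad A ((N - 2) / 4) (x N i - x N j + proj d N w) ^
      (-(((d : ℝ) - 1) / 2))) atTop
      (𝓝 (if j = i then (A + ∑ l, (w l : ℝ) ^ 2) ^ (-(((d : ℝ) - 1) / 2)) else 0)) := by
  have hα : 0 < ((d : ℝ) - 1) / 2 := by
    have : (2 : ℝ) ≤ d := by exact_mod_cast hd
    linarith
  split_ifs with hij
  · subst hij
    obtain ⟨n, hn⟩ : ∃ n : ℕ, ∀ j, |w j| ≤ n := by
      refine ⟨(∑ j, |w j|).toNat, fun j => ?_⟩
      have := Finset.single_le_sum (f := fun j => |w j|) (fun i _ => abs_nonneg _)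
        (Finset.mem_univ j)
      omega
    refine tendsto_const_nhds.congr' ?_
    filter_upwards [eventually_ge_atTop (4 * n + 10)] with N hN
    have : NeZero N := ⟨by omega⟩
    rw [sub_self, zero_add, cylQuad_proj (by omega) A fun l => (hn l).trans (by omega)]
  · refine (tendsto_rpow_neg_atTop hα).comp ?_
    have h1 : Tendsto (fun N => (cylDist (x N i) (x N j) ^ 2 - 2 * ∑ l, (w l : ℝ) ^ 2) / 32)
        atTop atTop := by
      refine Tendsto.atTop_div_const (by norm_num) (tendsto_atTop_add_const_right _ _ ?_)
      exact (tendsto_pow_atTop two_ne_zero).comp (hx i j (Ne.symm hij))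
    refine tendsto_atTop_mono' _ ?_ h1
    filter_upwards [eventually_ge_atTop 10] with N hN
    have : NeZero N := ⟨by omega⟩
    have := cylDist_sq_le (m := (N - 2) / 4) (by omega) (by linarith : 0 ≤ A) (x N i) (x N j) w
    rw [div_le_iff₀ (by norm_num)]
    linarith

theorem eventually_hitProb_le (hd : 2 ≤ d) {A : ℝ} (hA : 1 ≤ A)
    (hsuper : ∀ (N m η : ℕ) [NeZero N], 1 ≤ m → 4 * m + 2 ≤ N → ∀ x : Cyl d N,
      stepAvg (cylStep d N) (barrier A m η) x ≤ barrier A m η x)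
    (hheight : ∀ i ∈ I, ∀ c : ℕ, ∀ᶠ N in atTop, |(x N i).2 - ζ N| + c < h N)
    (hC : ∀ N p, p ∈ C N ↔ ∃ i ∈ I, ∃ u ∈ K i, x N i + proj d N u = p)
    {i : Fin M} (hi : i ∈ I) (u : ZLat d) :
    ∀ᶠ N in atTop, hitProb (cylStep d N) (C N : Set (Cyl d N))
      (block d N (bigInterval (h N) (ζ N))) (x N i + proj d N u) ≤
      ∑ j ∈ I, ∑ k ∈ K j, A ^ (((d : ℝ) - 1) / 2) *
        (cylQuad A ((N - 2) / 4) (x N i - x N j + proj d N (u - k)) ^ (-(((d : ℝ) - 1) / 2)) +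
          16 * d * ((d : ℝ) - 1) * ((h N : ℝ) / (((N - 2) / 4 : ℕ) : ℝ) ^ d)) := by
  have hslab : ∀ᶠ N in atTop, ∀ j ∈ I, ∀ k ∈ K j,
      x N j + proj d N k ∈ block d N (bigInterval (h N) (ζ N)) := by
    rw [Finset.eventually_all]
    intro j hj
    rw [Finset.eventually_all]
    exact fun k _ => eventually_mem_slab hheight hj k
  filter_upwards [hslab, eventually_mem_slab hheight hi u, eventually_ge_atTop 10] with N hN hu hN10
  have : NeZero N := ⟨by omega⟩
  have hA0 : 0 < A := by linarith
  have hAα : 0 ≤ A ^ (((d : ℝ) - 1) / 2) := Real.rpow_nonneg hA0.le _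
  set S : Cyl d N → ℝ := fun y => ∑ j ∈ I, ∑ k ∈ K j, A ^ (((d : ℝ) - 1) / 2) *
    barrier A ((N - 2) / 4) (h N) (y - (x N j + proj d N k)) with hS
  have hnn : ∀ y : Cyl d N, |y.2 - ζ N| ≤ h N → ∀ j ∈ I, ∀ k ∈ K j,
      0 ≤ A ^ (((d : ℝ) - 1) / 2) *
        barrier A ((N - 2) / 4) (h N) (y - (x N j + proj d N k)) := by
    intro y hy j hj k hk
    refine mul_nonneg hAα (barrier_nonneg (by omega) hA0.le ?_)
    have h1 : ζ N - h N < (x N j + proj d N k).2 ∧ (x N j + proj d N k).2 < ζ N + h N :=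
      hN j hj k hk
    have h2 : (y - (x N j + proj d N k)).2 = y.2 - (x N j + proj d N k).2 := rfl
    rw [h2]
    have := abs_le.1 hy
    rw [abs_le]
    omega
  have hmain : hitProb (cylStep d N) (C N : Set (Cyl d N))
      (block d N (bigInterval (h N) (ζ N))) (x N i + proj d N u) ≤ S (x N i + proj d N u) := by
    refine hitProb_le_of_superharmonic S ?_ ?_ ?_ hu
    · intro y
      simp only [hS]
      rw [stepAvg_sum]
      refine Finset.sum_le_sum fun j _ => ?_
      rw [stepAvg_sum]
      refine Finset.sum_le_sum fun k _ => ?_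
      rw [stepAvg_const_mul, stepAvg_translate (cylStep d N)]
      exact mul_le_mul_of_nonneg_left (hsuper N _ _ (by omega) (by omega) _) hAα
    · intro y hy
      obtain ⟨j, hj, k, hk, rfl⟩ := (hC N y).1 hy
      have hy' : |(x N j + proj d N k).2 - ζ N| ≤ h N := by
        have h1 : ζ N - h N < (x N j + proj d N k).2 ∧ (x N j + proj d N k).2 < ζ N + h N :=
          hN j hj k hk
        rw [abs_le]
        omega
      have h1 := Finset.single_le_sum (f := fun k' => A ^ (((d : ℝ) - 1) / 2) *
        barrier A ((N - 2) / 4) (h N) (x N j + proj d N k - (x N j + proj d N k')))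
        (fun k' hk' => hnn _ hy' j hj k' hk') hk
      have h2 := Finset.single_le_sum (f := fun j' => ∑ k' ∈ K j', A ^ (((d : ℝ) - 1) / 2) *
        barrier A ((N - 2) / 4) (h N) (x N j + proj d N k - (x N j' + proj d N k')))
        (fun j' hj' => Finset.sum_nonneg fun k' hk' => hnn _ hy' j' hj' k' hk') hj
      refine le_trans ?_ (h1.trans h2)
      simp only [sub_self]
      calc (1 : ℝ) = A ^ (((d : ℝ) - 1) / 2) * A ^ (-(((d : ℝ) - 1) / 2)) := by
            rw [← Real.rpow_add hA0, add_neg_cancel, Real.rpow_zero]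
        _ ≤ _ := mul_le_mul_of_nonneg_left (le_barrier_zero (by omega) A _ _) hAα
    · intro y hy
      exact Finset.sum_nonneg fun j hj => Finset.sum_nonneg fun k hk => hnn y hy j hj k hk
  refine hmain.trans (Finset.sum_le_sum fun j _ => Finset.sum_le_sum fun k _ => ?_)
  refine mul_le_mul_of_nonneg_left ?_ hAα
  have e : x N i + proj d N u - (x N j + proj d N k) = x N i - x N j + proj d N (u - k) := by
    rw [proj_sub]
    abel
  rw [e]
  exact barrier_le (by omega) A _ _ _

/-- Near `x_i`, hitting probabilities on the cylinder converge to those on the lattice. -/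
theorem tendsto_hitProb (hd : 2 ≤ d)
    (hx : ∀ i j, i ≠ j → Tendsto (fun N => cylDist (x N i) (x N j)) atTop atTop)
    (hheight : ∀ i ∈ I, ∀ c : ℕ, ∀ᶠ N in atTop, |(x N i).2 - ζ N| + c < h N)
    (hh : Tendsto (fun N => (h N : ℝ) / (N : ℝ) ^ d) atTop (𝓝 0))
    (hC : ∀ N p, p ∈ C N ↔ ∃ i ∈ I, ∃ u ∈ K i, x N i + proj d N u = p)
    {i : Fin M} (hi : i ∈ I) (u : ZLat d) :
    Tendsto (fun N => hitProb (cylStep d N) (C N : Set (Cyl d N))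
      (block d N (bigInterval (h N) (ζ N))) (x N i + proj d N u)) atTop
      (𝓝 (hitProb (unitStep d) (K i : Set (ZLat d)) Set.univ u)) := by
  obtain ⟨A, hA, hsuper⟩ := barrier_superharmonic hd
  set v : ℕ → ZLat d → ℝ := fun N u => hitProb (cylStep d N) (C N : Set (Cyl d N))
      (block d N (bigInterval (h N) (ζ N))) (x N i + proj d N u) with hv
  change Tendsto (fun N => v N u) atTop _
  rw [tendsto_iff_ultrafilter]
  intro g hg
  have hcomp : ∀ u, ∃ V ∈ Set.Icc (0 : ℝ) 1, Tendsto (fun N => v N u) g (𝓝 V) := by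
    intro u
    refine isCompact_Icc.ultrafilter_le_nhds (g.map fun N => v N u) ?_
    rw [Ultrafilter.coe_map, le_principal_iff, mem_map]
    exact Eventually.of_forall fun N => ⟨hitProb_nonneg _ _ _ _, hitProb_le_one _ _ _ _⟩
  choose V hVmem hV using hcomp
  have hVeq := eq_hitProb_univ hd (K i) V A (A ^ (((d : ℝ) - 1) / 2)) (fun u => (hVmem u).1)
    ?_ ?_ ?_ u
  · rw [← hVeq]
    exact hV u
  · intro k hk
    refine tendsto_nhds_unique (hV k) (tendsto_const_nhds.congr' ?_)
    refine Eventually.filter_mono hg ?_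
    filter_upwards [eventually_mem_slab hheight hi k] with N hN
    exact (hitProb_of_mem _ hN (Finset.mem_coe.2 ((hC N _).2 ⟨i, hi, k, hk, rfl⟩))).symm
  · intro w hw
    have hlim : Tendsto (fun N => stepAvg (unitStep d) (v N) w) g (𝓝 (stepAvg (unitStep d) V w)) :=
      (tendsto_finsetSum _ fun p _ => hV (w + unitStep d p)).div_const _
    refine tendsto_nhds_unique ((hV w).congr' ?_) hlim
    refine Eventually.filter_mono hg ?_
    have hout : ∀ᶠ N in atTop, ∀ j ∈ I, ∀ k ∈ K j, x N i + proj d N w ≠ x N j + proj d N k := by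
      rw [Finset.eventually_all]
      intro j _
      rw [Finset.eventually_all]
      intro k hk
      refine eventually_translate_ne hx ?_
      rintro rfl rfl
      exact hw hk
    filter_upwards [hout, eventually_mem_slab hheight hi w] with N hN hB
    have hCw : x N i + proj d N w ∉ (C N : Set (Cyl d N)) := by
      intro hmem
      obtain ⟨j, hj, k, hk, heq⟩ := (hC N _).1 hmem
      exact hN j hj k hk heq.symm
    change hitProb _ _ _ _ = _
    rw [hitProb_eq_stepAvg _ hB hCw]
    simp only [stepAvg, hv, proj_add, add_assoc]
  · intro w
    have hT : Tendsto (fun N => ∑ j ∈ I, ∑ k ∈ K j, A ^ (((d : ℝ) - 1) / 2) *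
        (cylQuad A ((N - 2) / 4) (x N i - x N j + proj d N (w - k)) ^ (-(((d : ℝ) - 1) / 2)) +
          16 * d * ((d : ℝ) - 1) * ((h N : ℝ) / (((N - 2) / 4 : ℕ) : ℝ) ^ d))) atTop
        (𝓝 (∑ j ∈ I, ∑ k ∈ K j, A ^ (((d : ℝ) - 1) / 2) *
          ((if j = i then (A + ∑ l, (((w - k) l : ℤ) : ℝ) ^ 2) ^ (-(((d : ℝ) - 1) / 2)) else 0) +
            16 * d * ((d : ℝ) - 1) * 0))) :=
      tendsto_finsetSum _ fun j _ => tendsto_finsetSum _ fun k _ =>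
        ((tendsto_cylQuad_rpow hd hx hA i j (w - k)).add
          ((tendsto_height_ratio hh).const_mul _)).const_mul _
    have hle := le_of_tendsto_of_tendsto (hV w) (hT.mono_left hg)
      (Eventually.filter_mono hg (eventually_hitProb_le hd hA hsuper hheight hC hi w))
    refine hle.trans (le_of_eq ?_)
    rw [Finset.sum_eq_single_of_mem i hi]
    · simp
    · intro j _ hj
      simp [hj]

theorem tendsto_cylCap (hd : 2 ≤ d)
    (hx : ∀ i j, i ≠ j → Tendsto (fun N => cylDist (x N i) (x N j)) atTop atTop)
    (hheight : ∀ i ∈ I, ∀ c : ℕ, ∀ᶠ N in atTop, |(x N i).2 - ζ N| + c < h N)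
    (hh : Tendsto (fun N => (h N : ℝ) / (N : ℝ) ^ d) atTop (𝓝 0))
    (hC : ∀ N p, p ∈ C N ↔ ∃ i ∈ I, ∃ u ∈ K i, x N i + proj d N u = p) :
    Tendsto (fun N => cylCap (block d N (bigInterval (h N) (ζ N))) (C N)) atTop
      (𝓝 (∑ i ∈ I, latticeCap (K i))) := by
  have hlim : Tendsto (fun N => ∑ i ∈ I, ∑ k ∈ K i, (1 - stepAvg (unitStep d)
      (fun u => hitProb (cylStep d N) (C N : Set (Cyl d N))
        (block d N (bigInterval (h N) (ζ N))) (x N i + proj d N u)) k)) atTop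
      (𝓝 (∑ i ∈ I, latticeCap (K i))) := by
    refine tendsto_finsetSum _ fun i hi => ?_
    unfold latticeCap
    refine tendsto_finsetSum _ fun k _ => ?_
    rw [latticeLaw_real_no_return]
    refine Tendsto.const_sub _ (Tendsto.div_const (tendsto_finsetSum _ fun p _ => ?_) _)
    exact tendsto_hitProb hd hx hheight hh hC hi _
  refine hlim.congr' ?_
  have hslab : ∀ᶠ N in atTop, ∀ j ∈ I, ∀ k ∈ K j,
      x N j + proj d N k ∈ block d N (bigInterval (h N) (ζ N)) := by
    rw [Finset.eventually_all]
    intro j hj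
    rw [Finset.eventually_all]
    exact fun k _ => eventually_mem_slab hheight hj k
  have hinj : ∀ᶠ N in atTop, ∀ p ∈ I.sigma K, ∀ q ∈ I.sigma K, p ≠ q →
      x N p.1 + proj d N p.2 ≠ x N q.1 + proj d N q.2 := by
    rw [Finset.eventually_all]
    rintro ⟨i, u⟩ _
    rw [Finset.eventually_all]
    rintro ⟨j, k⟩ _
    by_cases hne : (⟨i, u⟩ : Σ _ : Fin M, ZLat d) = ⟨j, k⟩
    · exact Eventually.of_forall fun N h => absurd hne h
    · refine (eventually_translate_ne hx ?_).mono fun N h _ => h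
      rintro rfl rfl
      exact hne rfl
  filter_upwards [hslab, hinj, eventually_ge_atTop 1] with N hN hN' hN1
  have : NeZero N := ⟨by omega⟩
  have hsub : (C N : Set (Cyl d N)) ⊆ block d N (bigInterval (h N) (ζ N)) := by
    intro p hp
    obtain ⟨j, hj, k, hk, rfl⟩ := (hC N p).1 hp
    exact hN j hj k hk
  rw [Finset.sum_sigma', cylCap]
  refine Finset.sum_bij (fun p _ => x N p.1 + proj d N p.2) ?_ ?_ ?_ ?_
  · rintro ⟨i, u⟩ hp
    obtain ⟨hi, hu⟩ := Finset.mem_sigma.1 hp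
    exact (hC N _).2 ⟨i, hi, u, hu, rfl⟩
  · intro p hp q hq heq
    by_contra hne
    exact hN' p hp q hq hne heq
  · intro y hy
    obtain ⟨j, hj, k, hk, rfl⟩ := (hC N y).1 hy
    exact ⟨⟨j, k⟩, Finset.mem_sigma.2 ⟨hj, hk⟩, rfl⟩
  · rintro ⟨i, u⟩ hp
    obtain ⟨hi, hu⟩ := Finset.mem_sigma.1 hp
    rw [cylLaw_real_escape hsub (Finset.mem_coe.2 ((hC N _).2 ⟨i, hi, u, hu, rfl⟩))]
    simp only [stepAvg, proj_add, add_assoc]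

end capacity

/-! ### The clusters -/

section cluster

variable {d M : ℕ} {x : (N : ℕ) → Fin M → Cyl d N} {v : Fin M → ℝ}

theorem mem_cluster {a : ℝ} {i : Fin M} : i ∈ cluster v a ↔ v i = a := by
  simp [cluster]

theorem exists_topHeight_eq {N : ℕ} (x : Fin M → Cyl d N) {a : ℝ} (ha : (cluster v a).Nonempty) :
    ∃ i ∈ cluster v a, topHeight x v a = (x i).2 := by
  have hmem : topHeight x v a ∈ (fun i => (x i).2) '' (cluster v a : Set (Fin M)) :=
    Int.csSup_mem (Set.Nonempty.image _ ha)
      ((Finset.finite_toSet _).image _).bddAbove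
  obtain ⟨i, hi, h⟩ := hmem
  exact ⟨i, hi, h.symm⟩

theorem mem_clusterSet {N : ℕ} {x : Fin M → Cyl d N} {K : Fin M → Finset (ZLat d)} {a : ℝ}
    {p : Cyl d N} : p ∈ clusterSet x K v a ↔
      ∃ i ∈ cluster v a, ∃ u ∈ K i, x i + proj d N u = p := by
  simp [clusterSet]

theorem eventually_height_le {δ : ℕ → ℕ} (hδ_top : Tendsto δ atTop atTop)
    (hδ_large : ∀ i j, v i = v j →
      (fun N => 1 + |((x N i).2 : ℝ) - ((x N j).2 : ℝ)|) =o[atTop] (fun N => (δ N : ℝ)))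
    {a : ℝ} {i : Fin M} (hi : i ∈ cluster v a) (c : ℕ) :
    ∀ᶠ N in atTop, |(x N i).2 - topHeight (x N) v a| + c ≤ δ N := by
  have hall : ∀ᶠ N in atTop, ∀ j ∈ cluster v a, |(x N i).2 - (x N j).2| + c ≤ δ N := by
    rw [Finset.eventually_all]
    intro j hj
    have h1 := (hδ_large i j ((mem_cluster.1 hi).trans (mem_cluster.1 hj).symm)).bound
      (show (0 : ℝ) < 1 / 2 by norm_num)
    filter_upwards [h1, hδ_top.eventually_ge_atTop (2 * c)] with N h2 h3
    rw [Real.norm_of_nonneg (add_nonneg zero_le_one (abs_nonneg _)), Real.norm_natCast] at h2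
    have h3' : (2 * c : ℝ) ≤ δ N := by exact_mod_cast h3
    have h4 : |((x N i).2 : ℝ) - ((x N j).2 : ℝ)| + c ≤ δ N := by linarith
    exact_mod_cast h4
  filter_upwards [hall] with N hN
  obtain ⟨j, hj, h⟩ := exists_topHeight_eq (x N) ⟨i, hi⟩
  rw [h]
  exact hN j hj

theorem eventually_topHeight_separated
    (hv : ∀ i, Tendsto (fun N => ((x N i).2 : ℝ) / (N : ℝ) ^ d) atTop (𝓝 (v i))) {h : ℕ → ℕ}
    (hh : Tendsto (fun N => (h N : ℝ) / (N : ℝ) ^ d) atTop (𝓝 0)) {a b : ℝ} (hab : a ≠ b)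
    (ha : (cluster v a).Nonempty) (hb : (cluster v b).Nonempty) :
    ∀ᶠ N in atTop, 2 * (h N : ℤ) ≤ |topHeight (x N) v a - topHeight (x N) v b| := by
  have hall : ∀ᶠ N in atTop, ∀ i ∈ cluster v a, ∀ j ∈ cluster v b,
      2 * (h N : ℤ) ≤ |(x N i).2 - (x N j).2| := by
    rw [Finset.eventually_all]
    intro i hi
    rw [Finset.eventually_all]
    intro j hj
    have h1 := ((hv i).sub (hv j)).abs
    have h2 := hh.const_mul 2
    have hpos : (2 : ℝ) * 0 < |v i - v j| := by
      rw [mem_cluster.1 hi, mem_cluster.1 hj, mul_zero]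
      exact abs_pos.2 (sub_ne_zero.2 hab)
    filter_upwards [h2.eventually_lt h1 hpos, eventually_gt_atTop 0] with N hN hN0
    have hN' : (0 : ℝ) < (N : ℝ) ^ d := pow_pos (by exact_mod_cast hN0) _
    rw [← sub_div, abs_div, abs_of_pos hN', ← mul_div_assoc, div_lt_div_iff_of_pos_right hN'] at hN
    exact_mod_cast hN.le
  filter_upwards [hall] with N hN
  obtain ⟨i, hi, h1⟩ := exists_topHeight_eq (x N) ha
  obtain ⟨j, hj, h2⟩ := exists_topHeight_eq (x N) hb
  rw [h1, h2]
  exact hN i hi j hj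

end cluster

end CylinderWalk

theorem lemma4p2 (d : ℕ) (hd : 2 ≤ d) :
    ∃ c : ℝ, 0 < c ∧
      ∀ (M : ℕ) (hM : 1 ≤ M) (K : Fin M → Finset (ZLat d))
        (x : (N : ℕ) → Fin M → Cyl d N) (v : Fin M → ℝ)
        (hx : ∀ i j, i ≠ j → Tendsto (fun N => cylDist (x N i) (x N j)) atTop atTop)
        (hv : ∀ i, Tendsto (fun N => ((x N i).2 : ℝ) / (N : ℝ) ^ d) atTop (𝓝 (v i)))
        (L : ℕ) (w : Fin L → ℝ) (hw : StrictMono w) (hvw : Set.range v = Set.range w)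
        (h δ : ℕ → ℕ)
        (hh_top : Tendsto h atTop atTop) (hδ_top : Tendsto δ atTop atTop)
        (hh_small : (fun N => (h N : ℝ)) =o[atTop] (fun N => (N : ℝ) ^ d))
        (hh_large : ∀ᶠ N : ℕ in atTop, (N : ℝ) * Real.log N ^ 2 ≤ h N)
        (hδ_small : (fun N => (δ N : ℝ)) =o[atTop] (fun N => (h N : ℝ)))
        (hδ_large : ∀ i j, v i = v j →
          (fun N => 1 + |((x N i).2 : ℝ) - ((x N j).2 : ℝ)|) =o[atTop] (fun N => (δ N : ℝ))),
        (∀ᶠ N : ℕ in atTop, ∀ l : Fin L,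
          ∀ z₁ ∈ innerBdry (smallInterval (δ N) (topHeight (x N) v (w l))),
          ∀ z₂ ∈ bdry (bigInterval (h N) (topHeight (x N) v (w l))),
            ∃ Ψ : ℝ, |Ψ| ≤ c * ((δ N : ℝ) / (h N : ℝ)) ∧
              (excursionLaw d N (δ N) (h N) (fun m => topHeight (x N) v (w m)) z₁ z₂).real
                  {X | entranceTime (clusterSet (x N) K v (w l) : Set (Cyl d N)) X <
                    exitTime (block d N (bigInterval (h N) (topHeight (x N) v (w l)))) X} =
                ((d : ℝ) + 1) * ((h N : ℝ) / (N : ℝ) ^ d) *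
                  cylCap (block d N (bigInterval (h N) (topHeight (x N) v (w l))))
                    (clusterSet (x N) K v (w l)) * (1 + Ψ)) ∧
        (∀ l : Fin L,
          Tendsto
            (fun N => cylCap (block d N (bigInterval (h N) (topHeight (x N) v (w l))))
              (clusterSet (x N) K v (w l)))
            atTop (𝓝 (∑ i ∈ cluster v (w l), latticeCap (K i)))) := by
  refine ⟨20, by norm_num, ?_⟩
  intro M hM K x v hx hv L w hw hvw h δ hh_top hδ_top hh_small hh_large hδ_small hδ_large
  have hh : Tendsto (fun N => (h N : ℝ) / (N : ℝ) ^ d) atTop (𝓝 0) :=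
    hh_small.tendsto_div_nhds_zero
  have hδh : ∀ᶠ N in atTop, 2 * δ N ≤ h N := by
    filter_upwards [hδ_small.bound (show (0 : ℝ) < 1 / 2 by norm_num)] with N hN
    rw [Real.norm_natCast, Real.norm_natCast] at hN
    have : (2 * δ N : ℝ) ≤ h N := by linarith
    exact_mod_cast this
  have hne : ∀ l, (cluster v (w l)).Nonempty := by
    intro l
    obtain ⟨i, hi⟩ : w l ∈ Set.range v := hvw ▸ Set.mem_range_self l
    exact ⟨i, mem_cluster.2 hi⟩
  constructor
  · rw [eventually_all]
    intro l
    have hsep : ∀ᶠ N in atTop, ∀ m, m ≠ l →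
        2 * (h N : ℤ) ≤ |topHeight (x N) v (w m) - topHeight (x N) v (w l)| := by
      rw [eventually_all]
      intro m
      by_cases hm : m = l
      · exact Eventually.of_forall fun N h => absurd hm h
      · exact (eventually_topHeight_separated hv hh (hw.injective.ne hm) (hne m) (hne l)).mono
          fun N h _ => h
    have hin : ∀ᶠ N in atTop, ∀ i ∈ cluster v (w l), ∀ u ∈ K i,
        x N i + proj d N u ∈ block d N (smallInterval (δ N) (topHeight (x N) v (w l))) := by
      rw [Finset.eventually_all]
      intro i hi
      rw [Finset.eventually_all]
      intro u _
      filter_upwards [eventually_height_le hδ_top hδ_large hi (u (Fin.last d)).natAbs] with N hN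
      have h1 : (x N i + proj d N u).2 = (x N i).2 + u (Fin.last d) := rfl
      have h2 := abs_le.1 (le_refl |(x N i).2 - topHeight (x N) v (w l)|)
      change _ ≤ (x N i + proj d N u).2 ∧ (x N i + proj d N u).2 ≤ _
      rw [h1]
      omega
    filter_upwards [hsep, hin, hδh, hh_top.eventually_gt_atTop 0, eventually_gt_atTop 0]
      with N hN1 hN2 hN3 hN4 hN5 z₁ hz₁ z₂ hz₂
    have : NeZero N := ⟨hN5.ne'⟩
    refine excursionLaw_real_approx (fun m => topHeight (x N) v (w m)) l hN4 hN3 hN1 _ ?_ hz₁ hz₂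
    intro p hp
    obtain ⟨i, hi, u, hu, rfl⟩ := mem_clusterSet.1 (Finset.mem_coe.1 hp)
    exact hN2 i hi u hu
  · intro l
    refine tendsto_cylCap hd hx (fun i hi c => ?_) hh fun N p => mem_clusterSet
    filter_upwards [eventually_height_le hδ_top hδ_large hi c, hδh, hh_top.eventually_gt_atTop 0]
      with N h1 h2 h3
    omega
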